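/- **Theorem 3.1.** *Setting.* Let $(\Theta,\rho)$ be a compact metric space with its Borel $\sigma$-algebra, $\theta_0\in\Theta$, and $\Pi$ a Borel probability measure (the prior) on $\Theta$. For every $m\in\mathbb N$ there are $k=k_m$ subsets of data, and the full sample size is $n=km$. The $j$th subset ($1\le j\le k$) is $Y_{[j]}=(Y_{j1},\dots,Y_{jm})$ with independent, not necessarily identically distributed $Y_{ji}$; under $\theta$, $Y_{ji}$ has a density $p_{ji}(\cdot\mid\theta)$ with respect to a $\sigma$-finite measure $\nu_{ji}$, jointly measurable in $(\theta,y)$. All these objects may depend on $m$, while $\Theta,\rho,\theta_0,\Pi$ do not. For $\gamma=\gamma_m>0$ the $j$th subset posterior is $$\Pi_m(d\theta\mid Y_{[j]})=\frac{\{\prod_{i=1}^m p_{ji}(Y_{ji}\mid\theta)\}^{\gamma}\,\Pi(d\theta)}{\int_\Theta\{\prod_{i=1}^m p_{ji}(Y_{ji}\mid\theta')\}^{\gamma}\,\Pi(d\theta')}.$$ Let $h_{mj}(\theta,\theta')=\big[\frac1m\sum_{i=1}^m\int(\sqrt{p_{ji}(\cdot\mid\theta)}-\sqrt{p_{ji}(\cdot\mid\theta')})^2\,d\nu_{ji}\big]^{1/2}$.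 For $\Xi\subseteq\Theta$ and $u>0$ let $N_{[]}(u,\Xi,h_{mj})\in\mathbb N\cup\{\infty\}$ be the least number $N$ of pairs $(\boldsymbol l_s,\boldsymbol u_s)$, $s\le N$, of vectors of nonnegative measurable functions $l_{si},u_{si}$ ($i\le m$) such that for every $\theta\in\Xi$ there is an $s$ with $l_{si}\le p_{ji}(\cdot\mid\theta)\le u_{si}$ everywhere for all $i$ and $\frac1m\sum_i\int(\sqrt{u_{si}}-\sqrt{l_{si}})^2d\nu_{ji}\le u^2$. Put $H_{[]}=\log(1+N_{[]})$. $W_2$ is the Wasserstein distance of order 2 for $\rho$. *Assumptions.* Let $\alpha,C_L,g_1,g_2,D_1,D_2,D_3,\kappa,c_\pi$ be positive constants with $D_1\le 1$ and $D_2<D_1^2/2^{12}$, such that for all sufficiently large $m$ the following hold. - (A1) $g_1\gamma m\le n\le g_2\gamma m$. - (A2) $h_{mj}^2(\theta,\theta')\ge C_L\,\rho^{2\alpha}(\theta,\theta')$ for all $\theta,\theta'\in\Theta$ and all $j\le k$. - (A3) For a function $\Psi(u,r)\ge0$ of $u,r>0$ that does not depend on $m$ and is nonincreasing in $u$ and nondecreasing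 in $r$: for every $r>0$ with $r\ge D_3\log m/\sqrt m$, $$H_{[]}\big(u,\{\theta:h_{mj}(\theta,\theta_0)\le r\},h_{mj}\big)\le\Psi(u,r)\ \text{ for all } j\le k,\ u>0,\qquad \int_{D_1r^2/2^{12}}^{D_1r}\sqrt{\Psi(u,r)}\,du<D_2\sqrt m\,r^2 .$$ - (A4) For all $j\le k$, $$\Pi\Big(\theta:\tfrac1m\sum_{i=1}^mE_{\theta_0}\exp\Big(\kappa\log_+\frac{p_{ji}(Y_{ji}\mid\theta_0)}{p_{ji}(Y_{ji}\mid\theta)}\Big)-1\le\frac{\log^2m}{m}\Big)\ge\exp(-c_\pi k\log^2m),\qquad \log_+x=\max(\log x,0).$$ *Conclusion.* There is a constant $C_1>0$, depending only on $\alpha,C_L,g_1,g_2,D_1,D_2,D_3,\kappa,c_\pi$ (in particular not on $j$ or $m$), such that for all sufficiently large $m$ and all $j\le k$, $$E_{\theta_0}\,W_2^2\big(\Pi_m(\cdot\mid Y_{[j]}),\delta_{\theta_0}\big)\le C_1\Big(\frac{\log^2m}{m}\Big)^{1/\alpha},$$ where the expectation is over the joint law of $Y_{[j]}$ under $\theta_0$.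 -/

import Mathlib

open MeasureTheory Filter
open scoped ENNReal

universe u v

noncomputable section

namespace TemperedPosterior

/-- A dominated statistical experiment with parameter space `Θ` and `m` independent, not
necessarily identically distributed observations. The `i`-th observation lives in `Obs i`, and
under the parameter `θ` it has the density `p i θ` with respect to `ν i`. -/
structure Experiment (Θ : Type u) [MeasurableSpace Θ] (m : ℕ) where
  /-- sample space of the `i`-th observation -/
  Obs : Fin m → Type v
  /-- its sigma-algebra -/
  mObs : ∀ i, MeasurableSpace (Obs i)
  /-- dominating measure of the `i`-th observation -/
  ν : ∀ i, Measure (Obs i)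
  sigmaFinite_ν : ∀ i, SigmaFinite (ν i)
  /-- density of the `i`-th observation -/
  p : ∀ i, Θ → Obs i → ℝ
  measurable_p : ∀ i, Measurable (fun z : Θ × Obs i => p i z.1 z.2)
  nonneg_p : ∀ i θ y, 0 ≤ p i θ y
  lintegral_p : ∀ i θ, ∫⁻ y, ENNReal.ofReal (p i θ y) ∂(ν i) = 1

attribute [instance] Experiment.mObs Experiment.sigmaFinite_ν

variable {Θ : Type u} [MeasurableSpace Θ] {m : ℕ}

/-- The law of the `i`-th observation under `θ`. -/
def Experiment.law (E : Experiment.{u, v} Θ m) (θ : Θ) (i : Fin m) : Measure (E.Obs i) :=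
  (E.ν i).withDensity (fun y => ENNReal.ofReal (E.p i θ y))

/-- The joint law of the `m` independent observations under `θ`. -/
def Experiment.jointLaw (E : Experiment.{u, v} Θ m) (θ : Θ) : Measure (∀ i, E.Obs i) :=
  Measure.pi (E.law θ)

/-- The Hellinger distance `[∫ (√f - √g)² dν]^{1/2}` of two densities. -/
def hellinger {Y : Type v} [MeasurableSpace Y] (ν : Measure Y) (f g : Y → ℝ) : ℝ :=
  √(∫ y, (√(f y) - √(g y)) ^ 2 ∂ν)

/-- The pseudo Hellinger distance: the root mean square, over the observations, of the Hellinger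
distances of the individual densities. -/
def Experiment.pseudoHellinger (E : Experiment.{u, v} Θ m) (θ₁ θ₂ : Θ) : ℝ :=
  √((1 / (m : ℝ)) * ∑ i, hellinger (E.ν i) (E.p i θ₁) (E.p i θ₂) ^ 2)

/-- `E.IsBracketing δ Ξ N l u` : the `N` pairs `[l s, u s]` of vectors of nonnegative measurable
functions bracket the densities `(p i θ)_i`, `θ ∈ Ξ`, at width `δ`: each of these vectors lies
between `l s` and `u s` for some `s` with `(1/m) ∑ i, ∫ (√(u s i) - √(l s i))² dν_i ≤ δ²`. -/
def Experiment.IsBracketing (E : Experiment.{u, v} Θ m) (δ : ℝ) (Ξ : Set Θ) (N : ℕ)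
    (l u : Fin N → ∀ i, E.Obs i → ℝ) : Prop :=
  (∀ s i, Measurable (l s i) ∧ Measurable (u s i) ∧ ∀ y, 0 ≤ l s i y ∧ 0 ≤ u s i y) ∧
  ∀ θ ∈ Ξ, ∃ s, (∀ i y, l s i y ≤ E.p i θ y ∧ E.p i θ y ≤ u s i y) ∧
    (m : ℝ≥0∞)⁻¹ * ∑ i, ∫⁻ y, ENNReal.ofReal ((√(u s i y) - √(l s i y)) ^ 2) ∂(E.ν i)
      ≤ ENNReal.ofReal (δ ^ 2)

/-- The generalized bracketing number; it is `⊤` if no finite bracketing exists. -/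
def Experiment.bracketingNumber (E : Experiment.{u, v} Θ m) (δ : ℝ) (Ξ : Set Θ) : ℕ∞ :=
  ⨅ (N : ℕ) (_ : ∃ l u, E.IsBracketing δ Ξ N l u), (N : ℕ∞)

/-- The generalized bracketing entropy `log (1 + N)`, with values in `[0, ∞]`. -/
def Experiment.bracketingEntropy (E : Experiment.{u, v} Θ m) (δ : ℝ) (Ξ : Set Θ) : EReal :=
  ENNReal.log (1 + (E.bracketingNumber δ Ξ : ℝ≥0∞))

/-- `log₊ x = max (log x) 0`, for `x ∈ [0, ∞]`. -/
def logPlus (x : ℝ≥0∞) : EReal := max (ENNReal.log x) 0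

/-- `(1/m) ∑ i, E_{θ₀} exp (κ log₊ (p_i(Y_i | θ₀) / p_i(Y_i | θ)))`, with values in `[0, ∞]`. The
quotient is infinite where only `p_i(Y_i | θ)` vanishes. -/
def Experiment.expLogPlusMean (E : Experiment.{u, v} Θ m) (κ : ℝ) (θ₀ θ : Θ) : ℝ≥0∞ :=
  (m : ℝ≥0∞)⁻¹ * ∑ i, ∫⁻ y,
    EReal.exp ((κ : EReal) *
      logPlus (ENNReal.ofReal (E.p i θ₀ y) / ENNReal.ofReal (E.p i θ y))) ∂(E.law θ₀ i)

/-- The likelihood of the observations `y`, raised to the power `γ`. -/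
def Experiment.temperedLikelihood (E : Experiment.{u, v} Θ m) (γ : ℝ) (y : ∀ i, E.Obs i)
    (θ : Θ) : ℝ≥0∞ :=
  ENNReal.ofReal ((∏ i, E.p i θ (y i)) ^ γ)

/-- The posterior distribution for the given prior and the likelihood raised to the power `γ`. -/
def Experiment.posterior (E : Experiment.{u, v} Θ m) (prior : Measure Θ) (γ : ℝ)
    (y : ∀ i, E.Obs i) : Measure Θ :=
  (∫⁻ θ, E.temperedLikelihood γ y θ ∂prior)⁻¹ • prior.withDensity (E.temperedLikelihood γ y)

/-- The Wasserstein distance of order 2: the infimum is over the probability measures on the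
product with marginals `μ₁` and `μ₂`. -/
def W₂ {X : Type u} [PseudoEMetricSpace X] [MeasurableSpace X] (μ₁ μ₂ : Measure X) : ℝ≥0∞ :=
  (⨅ (π : Measure (X × X)) (_ : IsProbabilityMeasure π ∧ π.map Prod.fst = μ₁ ∧
    π.map Prod.snd = μ₂), ∫⁻ z, edist z.1 z.2 ^ 2 ∂π) ^ (1 / 2 : ℝ)

/-! In the following conditions `E m j` is the experiment of the `j`-th of `k m` subsets, each of
`m` observations, so that the full sample size is `n = k m * m`. -/

variable {k : ℕ → ℕ}

/-- The power `γ` is of the order `n / m`. -/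
def PowerCondition (k : ℕ → ℕ) (γ : ℕ → ℝ) (g₁ g₂ : ℝ) : Prop :=
  ∀ᶠ m : ℕ in atTop, 0 < γ m ∧ g₁ * γ m * m ≤ (k m * m : ℕ) ∧ ((k m * m : ℕ) : ℝ) ≤ g₂ * γ m * m

/-- The pseudo Hellinger distances dominate a power of the metric. -/
def SeparationCondition [MetricSpace Θ] (E : ∀ m, Fin (k m) → Experiment.{u, v} Θ m)
    (α C_L : ℝ) : Prop :=
  ∀ᶠ m : ℕ in atTop, ∀ (j : Fin (k m)) (θ θ' : Θ),
    C_L * dist θ θ' ^ (2 * α) ≤ (E m j).pseudoHellinger θ θ' ^ 2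

/-- The entropy condition, for radii `r` of at least the order `log m / √m`. -/
def EntropyCondition (E : ∀ m, Fin (k m) → Experiment.{u, v} Θ m) (θ₀ : Θ)
    (D₁ D₂ D₃ : ℝ) : Prop :=
  ∃ Ψ : ℝ → ℝ → ℝ,
    (∀ u r, 0 < u → 0 < r → 0 ≤ Ψ u r) ∧
    (∀ r, 0 < r → AntitoneOn (fun u => Ψ u r) (Set.Ioi 0)) ∧
    (∀ u, 0 < u → MonotoneOn (fun r => Ψ u r) (Set.Ioi 0)) ∧
    ∀ᶠ m : ℕ in atTop, ∀ r : ℝ, 0 < r → D₃ * (Real.log m / √m) ≤ r →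
      (∀ (j : Fin (k m)) (u : ℝ), 0 < u →
        (E m j).bracketingEntropy u {θ | (E m j).pseudoHellinger θ θ₀ ≤ r} ≤ (Ψ u r : EReal)) ∧
      ∫ u in (D₁ * r ^ 2 / 2 ^ 12)..(D₁ * r), √(Ψ u r) < D₂ * √m * r ^ 2

/-- Prior thickness at `θ₀`. -/
def PriorThickness (E : ∀ m, Fin (k m) → Experiment.{u, v} Θ m) (prior : Measure Θ) (θ₀ : Θ)
    (κ c_π : ℝ) : Prop :=
  ∀ᶠ m : ℕ in atTop, ∀ j : Fin (k m),
    ENNReal.ofReal (Real.exp (-c_π * k m * Real.log m ^ 2)) ≤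
      prior {θ | (E m j).expLogPlusMean κ θ₀ θ ≤ 1 + ENNReal.ofReal (Real.log m ^ 2 / m)}

end TemperedPosterior

end

namespace TemperedPosterior

/-! Write L = log² m and let h be the pseudo Hellinger distance to θ₀. The product coupling bounds
W₂² to the point mass by the posterior mean of ρ²(θ, θ₀). By separation, parameters with h ≤ M log m
/ √m contribute O((L/m)^{1/α}). Since h² ≤ 2, ρ² is bounded everywhere, so exceptional events of
probability O(e^{-L}) are harmless. It remains to compare far likelihoods with the normalizing
constant, both measured against the likelihood P₀ of θ₀.

Far likelihoods: put F = √(p_θ/p_{θ₀}). Under θ₀, averaging over the observations, F - 1 has mean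
-h²/2 and mean square at most h². The likelihood ratio is at most the exponential of twice the sum
of `cappedLog` F, so on a shell R/2 ≤ h ≤ R it is exponentially small unless a centred sum deviates
by order mR². A chaining argument controls this uniformly in θ (`measure_chaining_le`). The
approximants are running minima of upper brackets, so their increments are nonpositive. For
nonpositive variables e^x ≤ 1 + x + x²/2, so second moments alone give sub-Gaussian tails and no
truncation is needed. Summing over dyadic shells gives `EntropyCondition.eventually_measure_far_le`.

Normalizing constant: on the prior neighbourhood A, the product of the κ-th powers of
max(p_{θ₀}/p_θ, 1) has mean at most e^L. Applying Markov's inequality in the data and then in θ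
leaves half of A with likelihood at least exp(-3L/κ) P₀. Only then is the power γ taken, so κ need
not be comparable with γ (`Experiment.evidence_lower_bound`). Since k ≤ g₂ γ, the prior mass
exp(-c_π k L) of A costs at most a multiple of γL in the exponent, which M²γL/2 absorbs for large M.
-/

/-! ### The capped logarithm. -/

/-- A `1`-Lipschitz concave majorant of the logarithm: `x - 1` below `1` and `log x` above. -/
noncomputable def cappedLog (x : ℝ) : ℝ := Real.log (max x 1) + (min x 1 - 1)

lemma cappedLog_of_le {x : ℝ} (h : x ≤ 1) : cappedLog x = x - 1 := by
  simp [cappedLog, h]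

lemma cappedLog_of_ge {x : ℝ} (h : 1 ≤ x) : cappedLog x = Real.log x := by
  simp [cappedLog, h]

@[fun_prop]
lemma measurable_cappedLog : Measurable cappedLog := by
  unfold cappedLog; fun_prop

lemma cappedLog_mono : Monotone cappedLog := by
  intro x y h
  unfold cappedLog
  have h1 : Real.log (max x 1) ≤ Real.log (max y 1) :=
    Real.log_le_log (by positivity) (max_le_max_right _ h)
  have h2 : min x 1 ≤ min y 1 := min_le_min_right _ h
  linarith

/-- The Lipschitz bound carries L² control of the brackets over to the logarithms, although log
itself is unbounded near 0. -/
lemma cappedLog_sub_le {x y : ℝ} (h : x ≤ y) : cappedLog y - cappedLog x ≤ y - x := by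
  unfold cappedLog
  have hx : 1 ≤ max x 1 := le_max_right _ _
  have hxy : max x 1 ≤ max y 1 := max_le_max_right _ h
  have h1 : Real.log (max y 1) - Real.log (max x 1) ≤ max y 1 - max x 1 := by
    rw [← Real.log_div (by positivity) (by positivity)]
    refine (Real.log_le_sub_one_of_pos (by positivity)).trans ?_
    rw [div_sub_one (by positivity)]
    exact div_le_self (by linarith) hx
  have e1 := max_add_min x 1
  have e2 := max_add_min y 1
  linarith

lemma cappedLog_one : cappedLog 1 = 0 := by simp [cappedLog]

lemma abs_cappedLog_sub_le (x y : ℝ) : |cappedLog x - cappedLog y| ≤ |x - y| := by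
  rcases le_total x y with h | h
  · rw [abs_sub_comm, abs_sub_comm x, abs_of_nonneg (sub_nonneg.2 (cappedLog_mono h)),
      abs_of_nonneg (sub_nonneg.2 h)]
    exact cappedLog_sub_le h
  · rw [abs_of_nonneg (sub_nonneg.2 (cappedLog_mono h)), abs_of_nonneg (sub_nonneg.2 h)]
    exact cappedLog_sub_le h

lemma abs_cappedLog_le (x : ℝ) : |cappedLog x| ≤ |x - 1| := by
  simpa [cappedLog_one] using abs_cappedLog_sub_le x 1

lemma cappedLog_le (x : ℝ) : cappedLog x ≤ x - 1 := by
  rcases le_total x 1 with h | h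
  · rw [cappedLog_of_le h]
  · rw [cappedLog_of_ge h]; exact Real.log_le_sub_one_of_pos (by linarith)

lemma self_le_exp_cappedLog (x : ℝ) : x ≤ Real.exp (cappedLog x) := by
  rcases le_total x 1 with h | h
  · rw [cappedLog_of_le h]
    linarith [Real.add_one_le_exp (x - 1)]
  · rw [cappedLog_of_ge h, Real.exp_log (by linarith)]

/-! ### Exponential inequalities and Chernoff bounds. -/

/-- Compare with the quadratic lower bound of exp(-x): (1 + x + x²/2)(1 - x + x²/2) = 1 + x⁴/4 ≥ 1.
-/
lemma exp_le_of_nonpos {x : ℝ} (hx : x ≤ 0) : Real.exp x ≤ 1 + x + x ^ 2 / 2 := by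
  have h := Real.quadratic_le_exp_of_nonneg (x := -x) (by linarith)
  have h4 : 0 < 1 + -x + (-x) ^ 2 / 2 := by nlinarith
  rw [← neg_neg x, Real.exp_neg, inv_le_comm₀ (Real.exp_pos _) (by nlinarith)]
  refine le_trans ?_ h
  rw [inv_le_iff_one_le_mul₀ (by nlinarith)]
  nlinarith [sq_nonneg (x ^ 2)]

/-- With x = e^t, the inequality t/2 ≤ sinh(t/2) reads log x · √x ≤ x - 1; then square. -/
lemma log_sq_mul_le {x : ℝ} (hx : 1 ≤ x) : Real.log x ^ 2 * x ≤ (x - 1) ^ 2 := by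
  have hx0 : 0 < x := by linarith
  have hl : 0 ≤ Real.log x := Real.log_nonneg hx
  have h1 : Real.log x / 2 ≤ Real.sinh (Real.log x / 2) := Real.self_le_sinh_iff.2 (by linarith)
  rw [Real.sinh_eq] at h1
  have e1 : Real.exp (Real.log x / 2) = √x := by rw [Real.sqrt_eq_rpow, Real.rpow_def_of_pos hx0]; ring_nf
  have hs : 0 < √x := Real.sqrt_pos.2 hx0
  have hss : √x * √x = x := Real.mul_self_sqrt hx0.le
  rw [Real.exp_neg, e1] at h1
  have h2 : Real.log x * √x ≤ x - 1 := by
    have : Real.log x ≤ √x - (√x)⁻¹ := by linarith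
    calc Real.log x * √x ≤ (√x - (√x)⁻¹) * √x := by gcongr
      _ = x - 1 := by rw [sub_mul, hss, inv_mul_cancel₀ hs.ne']
  have h3 : (Real.log x * √x) ^ 2 ≤ (x - 1) ^ 2 := by gcongr
  calc Real.log x ^ 2 * x = (Real.log x * √x) ^ 2 := by rw [mul_pow, Real.sq_sqrt hx0.le]
    _ ≤ _ := h3

lemma exp_le_of_nonneg {y : ℝ} (hy : 0 ≤ y) : Real.exp y ≤ 1 + y + y ^ 2 * Real.exp y := by
  have e : Real.exp y * Real.exp (-y) = 1 := by rw [← Real.exp_add]; simp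
  have hp := Real.exp_pos y
  have h1 : 1 - y ≤ Real.exp (-y) := Real.one_sub_le_exp_neg y
  have h2 := mul_le_mul_of_nonneg_left h1 hp.le
  nlinarith

/-- For x ≥ 1 the remainder l² log² x · e^{l log x} is at most l² x log² x ≤ l² (x - 1)², because l
≤ 1. Hence the coarsest chaining level, whose summands have no sign, needs only a second moment. -/
lemma exp_mul_cappedLog_le {l x : ℝ} (hl : 0 ≤ l) (hl1 : l ≤ 1) :
    Real.exp (l * cappedLog x) ≤ 1 + l * cappedLog x + l ^ 2 / 2 * (2 * (x - 1) ^ 2) := by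
  rcases le_total x 1 with h | h
  · rw [cappedLog_of_le h]
    have := exp_le_of_nonpos (x := l * (x - 1)) (mul_nonpos_of_nonneg_of_nonpos hl (by linarith))
    nlinarith [sq_nonneg (l * (x - 1))]
  · rw [cappedLog_of_ge h]
    have hlog := Real.log_nonneg h
    have h1 := exp_le_of_nonneg (mul_nonneg hl hlog)
    have h2 : Real.exp (l * Real.log x) ≤ x := by
      calc _ ≤ Real.exp (Real.log x) := Real.exp_le_exp.2 (by nlinarith)
        _ = x := Real.exp_log (by linarith)
    have h3 := log_sq_mul_le h
    have h4 : Real.log x ^ 2 * Real.exp (l * Real.log x) ≤ (x - 1) ^ 2 :=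
      (mul_le_mul_of_nonneg_left h2 (sq_nonneg _)).trans h3
    have h5 := mul_le_mul_of_nonneg_left h4 (sq_nonneg l)
    nlinarith

lemma lintegral_pi_prod {ι : Type*} [Fintype ι] {X : ι → Type*} [∀ i, MeasurableSpace (X i)]
    (μ : ∀ i, Measure (X i)) [∀ i, IsProbabilityMeasure (μ i)] (f : ∀ i, X i → ℝ≥0∞)
    (hf : ∀ i, Measurable (f i)) :
    ∫⁻ x, ∏ i, f i (x i) ∂(Measure.pi μ) = ∏ i, ∫⁻ x, f i x ∂(μ i) := by
  have h := ProbabilityTheory.iIndepFun_pi (μ := μ) (X := f) (fun i => (hf i).aemeasurable)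
  rw [ProbabilityTheory.lintegral_prod_eq_prod_lintegral_of_indepFun Finset.univ _ h
    (fun i => (hf i).comp (measurable_pi_apply i))]
  refine Finset.prod_congr rfl fun i _ => ?_
  rw [← (measurePreserving_eval μ i).lintegral_comp (hf i)]

/-- A Chernoff bound for sums of independent variables `g i` whose exponential is controlled by
a quadratic function. -/
theorem chernoff_pi {ι : Type*} [Fintype ι] {X : ι → Type*} [∀ i, MeasurableSpace (X i)]
    (μ : ∀ i, Measure (X i)) [∀ i, IsProbabilityMeasure (μ i)] {g w : ∀ i, X i → ℝ}
    (hgm : ∀ i, Measurable (g i)) (hg : ∀ i, Integrable (g i) (μ i))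
    (hw : ∀ i, Integrable (w i) (μ i)) {l : ℝ} (hl : 0 ≤ l)
    (hexp : ∀ i x, Real.exp (l * g i x) ≤ 1 + l * g i x + l ^ 2 / 2 * w i x) (t : ℝ) :
    Measure.pi μ {x | t ≤ ∑ i, (g i (x i) - ∫ y, g i y ∂(μ i))} ≤
      ENNReal.ofReal (Real.exp (l ^ 2 / 2 * ∑ i, ∫ y, w i y ∂(μ i) - l * t)) := by
  set a : ι → ℝ := fun i => ∫ y, g i y ∂(μ i)
  set b : ι → ℝ := fun i => ∫ y, w i y ∂(μ i)
  have hmeas : ∀ i, Measurable fun x => ENNReal.ofReal (Real.exp (l * g i x)) := by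
    intro i; have := hgm i; fun_prop
  have h1 : ∀ i, ∫⁻ x, ENNReal.ofReal (Real.exp (l * g i x)) ∂(μ i) ≤
      ENNReal.ofReal (Real.exp (l * a i + l ^ 2 / 2 * b i)) := by
    intro i
    have hint : Integrable (fun x => 1 + l * g i x + l ^ 2 / 2 * w i x) (μ i) :=
      ((integrable_const 1).add ((hg i).const_mul l)).add ((hw i).const_mul _)
    calc _ ≤ ∫⁻ x, ENNReal.ofReal (1 + l * g i x + l ^ 2 / 2 * w i x) ∂(μ i) :=
          lintegral_mono fun x => ENNReal.ofReal_le_ofReal (hexp i x)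
      _ = ENNReal.ofReal (∫ x, (1 + l * g i x + l ^ 2 / 2 * w i x) ∂(μ i)) :=
          (ofReal_integral_eq_lintegral_ofReal hint
            (ae_of_all _ fun x => (Real.exp_pos _).le.trans (hexp i x))).symm
      _ = ENNReal.ofReal (1 + l * a i + l ^ 2 / 2 * b i) := by
          rw [integral_add (f := fun x => 1 + l * g i x)
            ((integrable_const 1).add ((hg i).const_mul l)) ((hw i).const_mul _),
            integral_add (integrable_const 1) ((hg i).const_mul l),
            integral_const_mul, integral_const_mul]
          simp [a, b]
      _ ≤ _ := ENNReal.ofReal_le_ofReal (by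
          linarith [Real.add_one_le_exp (l * a i + l ^ 2 / 2 * b i)])
  have h2 : ∫⁻ x, ∏ i, ENNReal.ofReal (Real.exp (l * g i (x i))) ∂(Measure.pi μ) ≤
      ENNReal.ofReal (Real.exp (∑ i, (l * a i + l ^ 2 / 2 * b i))) := by
    rw [lintegral_pi_prod μ _ hmeas, Real.exp_sum,
      ENNReal.ofReal_prod_of_nonneg fun i _ => (Real.exp_pos _).le]
    exact Finset.prod_le_prod' fun i _ => h1 i
  have h3 : {x : ∀ i, X i | t ≤ ∑ i, (g i (x i) - a i)} ⊆
      {x | ENNReal.ofReal (Real.exp (l * (t + ∑ i, a i))) ≤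
        ∏ i, ENNReal.ofReal (Real.exp (l * g i (x i)))} := by
    intro x hx
    simp only [Set.mem_ofPred_eq, Finset.sum_sub_distrib] at hx ⊢
    rw [← ENNReal.ofReal_prod_of_nonneg fun i _ => (Real.exp_pos _).le, ← Real.exp_sum,
      ← Finset.mul_sum]
    refine ENNReal.ofReal_le_ofReal (Real.exp_le_exp.2 (mul_le_mul_of_nonneg_left ?_ hl))
    linarith
  have h4 := mul_meas_ge_le_lintegral₀ (μ := Measure.pi μ)
    (f := fun x => ∏ i, ENNReal.ofReal (Real.exp (l * g i (x i))))
    (by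
      refine (Finset.measurable_prod _ fun i _ => ?_).aemeasurable
      exact (hmeas i).comp (measurable_pi_apply i))
    (ENNReal.ofReal (Real.exp (l * (t + ∑ i, a i))))
  refine (measure_mono h3).trans ?_
  have h5 := h4.trans h2
  rw [mul_comm, ← ENNReal.le_div_iff_mul_le (Or.inl (by simp [Real.exp_pos]))
    (Or.inl ENNReal.ofReal_ne_top), ← ENNReal.ofReal_div_of_pos (Real.exp_pos _),
    ← Real.exp_sub] at h5
  refine h5.trans (le_of_eq ?_)
  congr 2
  rw [Finset.sum_add_distrib, ← Finset.mul_sum, ← Finset.mul_sum]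
  ring

/-- Sub-Gaussian upper tail of a sum of independent nonpositive variables. -/
theorem subgaussian_pi_of_nonpos {ι : Type*} [Fintype ι] {X : ι → Type*}
    [∀ i, MeasurableSpace (X i)] (μ : ∀ i, Measure (X i)) [∀ i, IsProbabilityMeasure (μ i)]
    {g : ∀ i, X i → ℝ} (hgm : ∀ i, Measurable (g i)) (hg0 : ∀ i x, g i x ≤ 0)
    (hg : ∀ i, MemLp (g i) 2 (μ i)) {V t : ℝ} (hV : 0 < V) (ht : 0 ≤ t)
    (hgV : ∑ i, ∫ x, g i x ^ 2 ∂(μ i) ≤ V) :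
    Measure.pi μ {x | t ≤ ∑ i, (g i (x i) - ∫ y, g i y ∂(μ i))} ≤
      ENNReal.ofReal (Real.exp (-(t ^ 2 / (2 * V)))) := by
  have hl : 0 ≤ t / V := by positivity
  refine (chernoff_pi μ (w := fun i x => g i x ^ 2) hgm
    (fun i => (hg i).integrable (by norm_num)) (fun i => (hg i).integrable_sq) hl
    (fun i x => ?_) t).trans (ENNReal.ofReal_le_ofReal (Real.exp_le_exp.2 ?_))
  · have := exp_le_of_nonpos (mul_nonpos_of_nonneg_of_nonpos hl (hg0 i x))
    linarith
  · have h1 := mul_le_mul_of_nonneg_left hgV (show 0 ≤ (t / V) ^ 2 / 2 by positivity)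
    have h2 : (t / V) ^ 2 / 2 * V - t / V * t = -(t ^ 2 / (2 * V)) := by field_simp; ring
    linarith

/-- A union bound over a family that depends on its index through finitely many values. -/
lemma measure_iUnion_le_of_factor {Y T K : Type*} [MeasurableSpace Y] (μ : Measure Y) [Fintype K]
    (c : T → K) (B : T → Set Y) (hB : ∀ θ θ', c θ = c θ' → B θ = B θ') {b : ℝ≥0∞}
    (hb : ∀ θ, μ (B θ) ≤ b) : μ (⋃ θ, B θ) ≤ Fintype.card K * b := by
  classical
  have h1 : (⋃ θ, B θ) ⊆ ⋃ k : K, if h : ∃ θ, c θ = k then B h.choose else ∅ := by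
    refine Set.iUnion_subset fun θ => Set.subset_iUnion_of_subset (c θ) ?_
    have h : ∃ θ', c θ' = c θ := ⟨θ, rfl⟩
    rw [dif_pos h, hB _ _ h.choose_spec]
  refine (measure_mono h1).trans ((measure_iUnion_fintype_le _ _).trans ?_)
  calc _ ≤ ∑ _k : K, b := Finset.sum_le_sum fun k _ => by
        split_ifs with h
        · exact hb _
        · simp
    _ = _ := by simp

/-! ### Chaining with nested upper brackets. -/

section Chaining

set_option linter.unusedSectionVars false

variable {ι : Type*} [Fintype ι] {X : ι → Type*} {N : ℕ → ℕ}

/-- The pointwise minimum of the upper brackets selected by `c` on the levels `0, …, j`. -/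
def runningMin (U : ∀ j, Fin (N j) → ∀ i, X i → ℝ) (c : ∀ j, Fin (N j)) : ℕ → ∀ i, X i → ℝ
  | 0 => U 0 (c 0)
  | j + 1 => fun i x => min (runningMin U c j i x) (U (j + 1) (c (j + 1)) i x)

variable {U : ∀ j, Fin (N j) → ∀ i, X i → ℝ} {c : ∀ j, Fin (N j)}

lemma runningMin_congr {c' : ∀ j, Fin (N j)} {j : ℕ} (h : ∀ i ≤ j, c i = c' i) :
    runningMin U c j = runningMin U c' j := by
  induction j with
  | zero => simp [runningMin, h 0 le_rfl]
  | succ j ih =>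
    simp only [runningMin]
    rw [ih fun i hi => h i (by omega), h (j + 1) le_rfl]

lemma runningMin_le (j : ℕ) (i : ι) (x : X i) : runningMin U c j i x ≤ U j (c j) i x := by
  cases j with
  | zero => exact le_rfl
  | succ j => exact min_le_right _ _

lemma runningMin_succ_le (j : ℕ) (i : ι) (x : X i) :
    runningMin U c (j + 1) i x ≤ runningMin U c j i x := min_le_left _ _

lemma le_runningMin {f : ∀ i, X i → ℝ} (h : ∀ j i x, f i x ≤ U j (c j) i x) (j : ℕ) (i : ι)
    (x : X i) : f i x ≤ runningMin U c j i x := by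
  induction j with
  | zero => exact h 0 i x
  | succ j ih => exact le_min ih (h _ i x)

variable [∀ i, MeasurableSpace (X i)]

lemma measurable_runningMin (hU : ∀ j s i, Measurable (U j s i)) (j : ℕ) (i : ι) :
    Measurable (runningMin U c j i) := by
  induction j with
  | zero => exact hU 0 _ i
  | succ j ih => exact ih.min (hU _ _ i)

variable (μ : ∀ i, Measure (X i)) [∀ i, IsProbabilityMeasure (μ i)]

variable {f : ∀ i, X i → ℝ}

lemma memLp_runningMin_sub (hU : ∀ j s i, Measurable (U j s i)) (hfm : ∀ i, Measurable (f i))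
    (h : ∀ j i x, f i x ≤ U j (c j) i x)
    (hUf : ∀ j i, MemLp (fun x => U j (c j) i x - f i x) 2 (μ i)) (j : ℕ) (i : ι) :
    MemLp (fun x => runningMin U c j i x - f i x) 2 (μ i) := by
  refine (hUf j i).mono ((measurable_runningMin hU j i).sub (hfm i)).aestronglyMeasurable
    (ae_of_all _ fun x => ?_)
  rw [Real.norm_eq_abs, Real.norm_eq_abs, abs_of_nonneg (sub_nonneg.2 (le_runningMin h j i x)),
    abs_of_nonneg (sub_nonneg.2 (h j i x))]
  linarith [runningMin_le (U := U) (c := c) j i x]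

lemma memLp_cappedLog_runningMin (hU : ∀ j s i, Measurable (U j s i))
    (hfm : ∀ i, Measurable (f i)) (h : ∀ j i x, f i x ≤ U j (c j) i x)
    (hf : ∀ i, MemLp (fun x => f i x - 1) 2 (μ i))
    (hUf : ∀ j i, MemLp (fun x => U j (c j) i x - f i x) 2 (μ i)) (j : ℕ) (i : ι) :
    MemLp (fun x => cappedLog (runningMin U c j i x)) 2 (μ i) := by
  refine ((memLp_runningMin_sub μ hU hfm h hUf j i).add (hf i)).mono
    (measurable_cappedLog.comp (measurable_runningMin hU j i)).aestronglyMeasurable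
    (ae_of_all _ fun x => ?_)
  have := abs_cappedLog_le (runningMin U c j i x)
  simpa [Real.norm_eq_abs] using this

/-- The centred sum of the capped logarithms of the running minimum. -/
noncomputable def centredSum (U : ∀ j, Fin (N j) → ∀ i, X i → ℝ) (c : ∀ j, Fin (N j)) (j : ℕ)
    (y : ∀ i, X i) : ℝ :=
  ∑ i, (cappedLog (runningMin U c j i (y i)) - ∫ x, cappedLog (runningMin U c j i x) ∂(μ i))

lemma measure_centredSum_zero (hU : ∀ j s i, Measurable (U j s i))
    (hfm : ∀ i, Measurable (f i)) (h : ∀ j i x, f i x ≤ U j (c j) i x)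
    (hf : ∀ i, MemLp (fun x => f i x - 1) 2 (μ i))
    (hUf : ∀ j i, MemLp (fun x => U j (c j) i x - f i x) 2 (μ i)) {a b : ℝ}
    (ha : ∑ i, ∫ x, (f i x - 1) ^ 2 ∂(μ i) ≤ a)
    (hb : ∑ i, ∫ x, (U 0 (c 0) i x - f i x) ^ 2 ∂(μ i) ≤ b)
    {l : ℝ} (hl : 0 ≤ l) (hl1 : l ≤ 1) (t : ℝ) :
    Measure.pi μ {y | t ≤ centredSum μ U c 0 y} ≤
      ENNReal.ofReal (Real.exp (2 * l ^ 2 * (a + b) - l * t)) := by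
  have hU1 : ∀ i, MemLp (fun x => U 0 (c 0) i x - 1) 2 (μ i) := fun i => by
    have := (hUf 0 i).add (hf i)
    refine this.congr_norm ((hU 0 _ i).sub_const 1).aestronglyMeasurable (ae_of_all _ fun x => ?_)
    simp
  refine (chernoff_pi μ (w := fun i x => 2 * (U 0 (c 0) i x - 1) ^ 2)
    (fun i => measurable_cappedLog.comp (measurable_runningMin hU 0 i))
    (fun i => (memLp_cappedLog_runningMin μ hU hfm h hf hUf 0 i).integrable (by norm_num))
    (fun i => (hU1 i).integrable_sq.const_mul 2) hl (fun i x => exp_mul_cappedLog_le hl hl1)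
    t).trans (ENNReal.ofReal_le_ofReal (Real.exp_le_exp.2 ?_))
  have h1 : ∑ i, ∫ x, 2 * (U 0 (c 0) i x - 1) ^ 2 ∂(μ i) ≤ 4 * (a + b) := by
    calc _ ≤ ∑ i, ∫ x, (4 * (f i x - 1) ^ 2 + 4 * (U 0 (c 0) i x - f i x) ^ 2) ∂(μ i) := by
          refine Finset.sum_le_sum fun i _ => integral_mono ((hU1 i).integrable_sq.const_mul 2)
            (((hf i).integrable_sq.const_mul 4).add ((hUf 0 i).integrable_sq.const_mul 4))
            fun x => ?_
          have := sq_nonneg ((f i x - 1) - (U 0 (c 0) i x - f i x))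
          simp only
          nlinarith
      _ = 4 * ∑ i, ∫ x, (f i x - 1) ^ 2 ∂(μ i) +
            4 * ∑ i, ∫ x, (U 0 (c 0) i x - f i x) ^ 2 ∂(μ i) := by
          rw [Finset.mul_sum, Finset.mul_sum, ← Finset.sum_add_distrib]
          refine Finset.sum_congr rfl fun i _ => ?_
          rw [integral_add ((hf i).integrable_sq.const_mul 4)
            ((hUf 0 i).integrable_sq.const_mul 4), integral_const_mul, integral_const_mul]
      _ ≤ _ := by linarith
  have := mul_le_mul_of_nonneg_left h1 (show 0 ≤ l ^ 2 / 2 by positivity)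
  linarith

/-- The increments are nonpositive because the running minimum decreases. From f ≤ min_{j+1} ≤ min_j
≤ U_j and the Lipschitz bound they are at least -(U_j - f), so the bracket width of level j bounds
their second moment. -/
lemma measure_centredSum_succ (hU : ∀ j s i, Measurable (U j s i))
    (hfm : ∀ i, Measurable (f i)) (h : ∀ j i x, f i x ≤ U j (c j) i x)
    (hf : ∀ i, MemLp (fun x => f i x - 1) 2 (μ i))
    (hUf : ∀ j i, MemLp (fun x => U j (c j) i x - f i x) 2 (μ i)) (j : ℕ) {b : ℝ} (hb0 : 0 < b)
    (hb : ∑ i, ∫ x, (U j (c j) i x - f i x) ^ 2 ∂(μ i) ≤ b) {t : ℝ} (ht : 0 ≤ t) :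
    Measure.pi μ {y | t ≤ centredSum μ U c (j + 1) y - centredSum μ U c j y} ≤
      ENNReal.ofReal (Real.exp (-(t ^ 2 / (2 * b)))) := by
  have hL := memLp_cappedLog_runningMin μ hU hfm h hf hUf
  have hm : ∀ j i, Measurable fun x => cappedLog (runningMin U c j i x) := fun j i =>
    measurable_cappedLog.comp (measurable_runningMin hU j i)
  have hg : ∀ i, MemLp (fun x => cappedLog (runningMin U c (j + 1) i x) -
      cappedLog (runningMin U c j i x)) 2 (μ i) := fun i => (hL (j + 1) i).sub (hL j i)
  have h1 := subgaussian_pi_of_nonpos μ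
    (g := fun i x => cappedLog (runningMin U c (j + 1) i x) - cappedLog (runningMin U c j i x))
    (fun i => (hm (j + 1) i).sub (hm j i))
    (fun i x => sub_nonpos.2 (cappedLog_mono (runningMin_succ_le j i x)))
    hg (V := b) (t := t) hb0 ht
    (by
      refine le_trans (Finset.sum_le_sum fun i _ => integral_mono (hg i).integrable_sq
        (hUf j i).integrable_sq fun x => ?_) hb
      have e1 := cappedLog_sub_le (runningMin_succ_le (U := U) (c := c) j i x)
      have e2 := cappedLog_mono (runningMin_succ_le (U := U) (c := c) j i x)
      have e3 := le_runningMin h (j + 1) i x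
      have e4 := runningMin_le (U := U) (c := c) j i x
      simp only
      apply sq_le_sq'
      · linarith
      · have := h j i x
        linarith)
  convert h1 using 2
  ext y
  simp only [centredSum, Set.mem_ofPred_eq, ← Finset.sum_sub_distrib]
  refine iff_of_eq (congrArg (t ≤ ·) (Finset.sum_congr rfl fun i _ => ?_))
  rw [integral_sub ((hL (j + 1) i).integrable (by norm_num)) ((hL j i).integrable (by norm_num))]
  ring

/-- The bias of stopping at level j: `cappedLog` x ≤ x - 1 isolates the mean of f - 1, and U - f ≤
(U - f)²/(2d) + d/2 replaces Cauchy–Schwarz, over observations and integrals at once. -/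
lemma sum_integral_cappedLog_le (hU : ∀ j s i, Measurable (U j s i))
    (hfm : ∀ i, Measurable (f i)) (h : ∀ j i x, f i x ≤ U j (c j) i x)
    (hf : ∀ i, MemLp (fun x => f i x - 1) 2 (μ i))
    (hUf : ∀ j i, MemLp (fun x => U j (c j) i x - f i x) 2 (μ i)) (j : ℕ) {d : ℝ} (hd : 0 < d)
    (hb : ∑ i, ∫ x, (U j (c j) i x - f i x) ^ 2 ∂(μ i) ≤ Fintype.card ι * d ^ 2) :
    ∑ i, ∫ x, cappedLog (runningMin U c j i x) ∂(μ i) ≤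
      ∑ i, ∫ x, (f i x - 1) ∂(μ i) + Fintype.card ι * d := by
  have i1 : ∀ i, Integrable (fun x => f i x - 1) (μ i) := fun i => (hf i).integrable (by norm_num)
  have i2 : ∀ i, Integrable (fun x => d⁻¹ / 2 * (U j (c j) i x - f i x) ^ 2) (μ i) :=
    fun i => (hUf j i).integrable_sq.const_mul _
  calc _ ≤ ∑ i, ∫ x, ((f i x - 1) + d⁻¹ / 2 * (U j (c j) i x - f i x) ^ 2 + d / 2) ∂(μ i) := by
        refine Finset.sum_le_sum fun i _ => integral_mono
          ((memLp_cappedLog_runningMin μ hU hfm h hf hUf j i).integrable (by norm_num))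
          (((i1 i).add (i2 i)).add (integrable_const _)) fun x => ?_
        have e1 := cappedLog_le (runningMin U c j i x)
        have e2 := runningMin_le (U := U) (c := c) j i x
        have e3 : U j (c j) i x - f i x ≤
            d⁻¹ / 2 * (U j (c j) i x - f i x) ^ 2 + d / 2 := by
          have e4 : 0 ≤ d⁻¹ / 2 * ((U j (c j) i x - f i x) - d) ^ 2 := by positivity
          have e5 : d⁻¹ * d = 1 := inv_mul_cancel₀ hd.ne'
          have e6 : d⁻¹ / 2 * ((U j (c j) i x - f i x) - d) ^ 2 =
              d⁻¹ / 2 * (U j (c j) i x - f i x) ^ 2 - (d⁻¹ * d) * (U j (c j) i x - f i x)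
                + (d⁻¹ * d) * d / 2 := by ring
          rw [e6, e5] at e4
          linarith
        simp only
        linarith
    _ = ∑ i, ∫ x, (f i x - 1) ∂(μ i) +
          (d⁻¹ / 2 * ∑ i, ∫ x, (U j (c j) i x - f i x) ^ 2 ∂(μ i) +
            Fintype.card ι * (d / 2)) := by
        rw [Finset.mul_sum, ← nsmul_eq_mul, ← Finset.card_univ, ← Finset.sum_const,
          ← Finset.sum_add_distrib, ← Finset.sum_add_distrib]
        refine Finset.sum_congr rfl fun i _ => ?_
        rw [integral_add (f := fun x => (f i x - 1) + d⁻¹ / 2 * (U j (c j) i x - f i x) ^ 2)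
          ((i1 i).add (i2 i)) (integrable_const _), integral_add (i1 i) (i2 i),
          integral_const_mul]
        simp [add_assoc]
    _ ≤ _ := by
        have := mul_le_mul_of_nonneg_left hb (show 0 ≤ d⁻¹ / 2 by positivity)
        have e : d⁻¹ / 2 * (Fintype.card ι * d ^ 2) = Fintype.card ι * d / 2 := by
          field_simp
        linarith

lemma centredSum_lt_of_increments {t : ℕ → ℝ} {J : ℕ} {y : ∀ i, X i}
    (h0 : centredSum μ U c 0 y < t 0)
    (h : ∀ j < J, centredSum μ U c (j + 1) y - centredSum μ U c j y < t (j + 1)) :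
    centredSum μ U c J y < ∑ j ∈ Finset.range (J + 1), t j := by
  induction J with
  | zero => simpa using h0
  | succ J ih =>
    rw [Finset.sum_range_succ]
    have := ih fun j hj => h j (by omega)
    have := h J (by omega)
    linarith

/-- The chaining bound with nested upper brackets. The functions `F θ` are bracketed from above,
on level `j`, by the `N j ≤ exp (H j)` functions `U j`, up to `δ j` in root mean square. -/
theorem measure_chaining_le {T : Type*} (hU : ∀ j s i, Measurable (U j s i))
    {F : T → ∀ i, X i → ℝ} (hFm : ∀ θ i, Measurable (F θ i)) (s : ∀ j, T → Fin (N j))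
    (h : ∀ θ j i x, F θ i x ≤ U j (s j θ) i x)
    (hF : ∀ θ i, MemLp (fun x => F θ i x - 1) 2 (μ i))
    (hUF : ∀ θ j i, MemLp (fun x => U j (s j θ) i x - F θ i x) 2 (μ i))
    {a : ℝ} (ha : ∀ θ, ∑ i, ∫ x, (F θ i x - 1) ^ 2 ∂(μ i) ≤ a)
    {δ : ℕ → ℝ} (hδ : ∀ j, 0 < δ j) (hι : 0 < Fintype.card ι)
    (hb : ∀ θ j, ∑ i, ∫ x, (U j (s j θ) i x - F θ i x) ^ 2 ∂(μ i) ≤ Fintype.card ι * δ j ^ 2)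
    {H : ℕ → ℝ} (hN : ∀ j, (N j : ℝ) ≤ Real.exp (H j))
    {l : ℝ} (hl : 0 ≤ l) (hl1 : l ≤ 1) {t : ℕ → ℝ} (ht : ∀ j, 0 ≤ t j) (J : ℕ) :
    Measure.pi μ {y | ∃ θ, ∑ j ∈ Finset.range (J + 1), t j + (∑ i, ∫ x, (F θ i x - 1) ∂(μ i)
        + Fintype.card ι * δ J) ≤ ∑ i, cappedLog (F θ i (y i))} ≤
      ENNReal.ofReal (Real.exp (H 0 + (2 * l ^ 2 * (a + Fintype.card ι * δ 0 ^ 2) - l * t 0))) +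
      ∑ j ∈ Finset.range J, ENNReal.ofReal (Real.exp (∑ i ∈ Finset.range (j + 2), H i -
        t (j + 1) ^ 2 / (2 * (Fintype.card ι * δ j ^ 2)))) := by
  set c : T → ∀ j, Fin (N j) := fun θ j => s j θ
  set B : ℕ → T → Set (∀ i, X i) := fun j θ =>
    {y | t (j + 1) ≤ centredSum μ U (c θ) (j + 1) y - centredSum μ U (c θ) j y}
  -- If no level exceeds its threshold, the telescoped sum at level J is too small for the event; f
  -- ≤ min_J and monotonicity pass from F to the running minimum.
  have hsub : {y | ∃ θ, ∑ j ∈ Finset.range (J + 1), t j + (∑ i, ∫ x, (F θ i x - 1) ∂(μ i)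
        + Fintype.card ι * δ J) ≤ ∑ i, cappedLog (F θ i (y i))} ⊆
      (⋃ θ, {y | t 0 ≤ centredSum μ U (c θ) 0 y}) ∪ ⋃ j ∈ Finset.range J, ⋃ θ, B j θ := by
    rintro y ⟨θ, hθ⟩
    by_contra hy
    simp only [Set.mem_union, Set.mem_iUnion, Finset.mem_range, not_or, not_exists,
      Set.mem_ofPred_eq, not_le, B] at hy
    have h1 := centredSum_lt_of_increments μ (hy.1 θ) (fun j hj => hy.2 j hj θ)
    have h2 := sum_integral_cappedLog_le μ hU (hFm θ) (h θ) (hF θ) (hUF θ) J (hδ J) (hb θ J)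
    have h3 : ∑ i, cappedLog (F θ i (y i)) ≤
        ∑ i, cappedLog (runningMin U (c θ) J i (y i)) :=
      Finset.sum_le_sum fun i _ => cappedLog_mono (le_runningMin (h θ) J i (y i))
    rw [centredSum, Finset.sum_sub_distrib] at h1
    linarith
  -- The bad event of level j depends on θ only through the brackets selected up to that level, so
  -- even an uncountable family yields at most ∏ N i events.
  have hcard : ∀ j, (Fintype.card (∀ i : Fin (j + 1), Fin (N i)) : ℝ≥0∞) ≤
      ENNReal.ofReal (Real.exp (∑ i ∈ Finset.range (j + 1), H i)) := by
    intro j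
    rw [Fintype.card_pi, ← ENNReal.ofReal_natCast]
    refine ENNReal.ofReal_le_ofReal ?_
    rw [Real.exp_sum, Finset.prod_range]
    push_cast
    refine Finset.prod_le_prod (fun i _ => Nat.cast_nonneg _) fun i _ => ?_
    simpa using hN i
  have hc0 : 0 < (Fintype.card ι : ℝ) := by exact_mod_cast hι
  refine (measure_mono hsub).trans ((measure_union_le _ _).trans (add_le_add ?_ ?_))
  · refine (measure_iUnion_le_of_factor _ (fun θ (i : Fin (0 + 1)) => c θ i) _ ?_ (fun θ =>
      measure_centredSum_zero μ hU (hFm θ) (h θ) (hF θ) (hUF θ) (ha θ) (hb θ 0) hl hl1 (t 0))).trans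
      ?_
    · intro θ θ' hθ
      have : runningMin U (s · θ) 0 = runningMin U (s · θ') 0 := runningMin_congr fun i hi =>
        congrFun hθ ⟨i, by omega⟩
      simp only [centredSum, this]
    · refine (mul_le_mul_left (hcard 0) _).trans ?_
      rw [← ENNReal.ofReal_mul (Real.exp_pos _).le, ← Real.exp_add]
      simp
  · refine (measure_biUnion_finset_le _ _).trans (Finset.sum_le_sum fun j _ => ?_)
    refine (measure_iUnion_le_of_factor _ (fun θ (i : Fin (j + 1 + 1)) => c θ i) _ ?_ (fun θ =>
      measure_centredSum_succ μ hU (hFm θ) (h θ) (hF θ) (hUF θ) j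
        (mul_pos hc0 (pow_pos (hδ j) 2)) (hb θ j) (ht (j + 1)))).trans ?_
    · intro θ θ' hθ
      have e1 : runningMin U (s · θ) (j + 1) = runningMin U (s · θ') (j + 1) :=
        runningMin_congr fun i hi => congrFun hθ ⟨i, by omega⟩
      have e2 : runningMin U (s · θ) j = runningMin U (s · θ') j :=
        runningMin_congr fun i hi => congrFun hθ ⟨i, by omega⟩
      simp only [centredSum, e1, e2]
    · refine (mul_le_mul_left (hcard (j + 1)) _).trans ?_
      rw [← ENNReal.ofReal_mul (Real.exp_pos _).le, ← Real.exp_add]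
      exact le_of_eq (by rw [sub_eq_add_neg])

end Chaining

/-! ### Chaining along dyadic bracket widths. -/

lemma sqrt_add_le_add_sqrt {a b : ℝ} (ha : 0 ≤ a) (hb : 0 ≤ b) : √(a + b) ≤ √a + √b := by
  rw [Real.sqrt_le_left (by positivity)]
  nlinarith [Real.sq_sqrt ha, Real.sq_sqrt hb, Real.sqrt_nonneg a, Real.sqrt_nonneg b,
    mul_nonneg (Real.sqrt_nonneg a) (Real.sqrt_nonneg b)]

lemma sqrt_sum_range_le {H : ℕ → ℝ} (hH : ∀ j, 0 ≤ H j) (n : ℕ) :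
    √(∑ i ∈ Finset.range n, H i) ≤ ∑ i ∈ Finset.range n, √(H i) := by
  induction n with
  | zero => simp
  | succ n ih =>
    rw [Finset.sum_range_succ, Finset.sum_range_succ]
    exact (sqrt_add_le_add_sqrt (Finset.sum_nonneg fun i _ => hH i) (hH n)).trans (by linarith)

/-- Summation by parts for a sequence `δ` that is halved in each step. -/
lemma sum_halving_mul_partial_sum_le {δ q : ℕ → ℝ} (hδ : ∀ j, δ j = 2 * δ (j + 1))
    (hδ0 : ∀ j, 0 ≤ δ j) (hq : ∀ j, 0 ≤ q j) (J : ℕ) :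
    ∑ j ∈ Finset.range J, δ j * ∑ i ∈ Finset.range (j + 2), q i ≤
      4 * ∑ j ∈ Finset.range (J + 1), δ j * q j := by
  -- The extra term makes the induction close: halving δ releases exactly the amount that pays for
  -- the next partial sum.
  have key : ∑ j ∈ Finset.range J, δ j * ∑ i ∈ Finset.range (j + 2), q i +
      2 * δ J * ∑ i ∈ Finset.range (J + 1), q i ≤
      4 * ∑ j ∈ Finset.range (J + 1), δ j * q j := by
    induction J with
    | zero => simp; nlinarith [mul_nonneg (hδ0 0) (hq 0)]
    | succ J ih =>
      rw [Finset.sum_range_succ, Finset.sum_range_succ (fun j => δ j * q j),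
        Finset.sum_range_succ q (J + 1)]
      have e := hδ J
      rw [e] at ih ⊢
      nlinarith
  have : 0 ≤ 2 * δ J * ∑ i ∈ Finset.range (J + 1), q i :=
    mul_nonneg (by have := hδ0 J; positivity) (Finset.sum_nonneg fun i _ => hq i)
  linarith

lemma sum_halving_le {δ : ℕ → ℝ} (hδ : ∀ j, δ j = 2 * δ (j + 1)) (hδ0 : ∀ j, 0 ≤ δ j) (J : ℕ) :
    ∑ j ∈ Finset.range J, δ j ≤ 2 * δ 0 := by
  have key : ∑ j ∈ Finset.range J, δ j + 2 * δ J = 2 * δ 0 := by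
    induction J with
    | zero => simp
    | succ J ih => rw [Finset.sum_range_succ]; linarith [hδ J]
  linarith [hδ0 J]

/-- Chaining with dyadic bracket widths, for functions whose mean square distance from `1` is at
most `R²` and whose mean is bounded away from `1` by a multiple of `R²`. -/
theorem measure_chaining_dyadic_le {ι : Type*} [Fintype ι] {X : ι → Type*} {N : ℕ → ℕ}
    [∀ i, MeasurableSpace (X i)] (μ : ∀ i, Measure (X i)) [∀ i, IsProbabilityMeasure (μ i)]
    {U : ∀ j, Fin (N j) → ∀ i, X i → ℝ} {T : Type*} (hU : ∀ j s i, Measurable (U j s i))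
    {F : T → ∀ i, X i → ℝ} (hFm : ∀ θ i, Measurable (F θ i)) (s : ∀ j, T → Fin (N j))
    (h : ∀ θ j i x, F θ i x ≤ U j (s j θ) i x)
    (hF : ∀ θ i, MemLp (fun x => F θ i x - 1) 2 (μ i))
    (hUF : ∀ θ j i, MemLp (fun x => U j (s j θ) i x - F θ i x) 2 (μ i))
    (hι : 0 < Fintype.card ι) {n R d : ℝ} (hn : n = Fintype.card ι) (hR : 0 < R)
    (hd : 0 < d) (hd1 : d ≤ 1)
    (ha : ∀ θ, ∑ i, ∫ x, (F θ i x - 1) ^ 2 ∂(μ i) ≤ n * R ^ 2)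
    (hmean : ∀ θ, ∑ i, ∫ x, (F θ i x - 1) ∂(μ i) ≤ -(n * R ^ 2 / 8))
    (hb : ∀ θ j, ∑ i, ∫ x, (U j (s j θ) i x - F θ i x) ^ 2 ∂(μ i) ≤ n * (d * R / 2 ^ j) ^ 2)
    {H : ℕ → ℝ} (hH : ∀ j, 0 ≤ H j) (hN : ∀ j, (N j : ℝ) ≤ Real.exp (H j)) {J : ℕ}
    (hJ : d * R / 2 ^ J ≤ R ^ 2 / 64)
    (hent : ∑ j ∈ Finset.range (J + 1), d * R / 2 ^ j * √(H j) ≤ d / 2 ^ 10 * √n * R ^ 2) :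
    Measure.pi μ {y | ∃ θ, -(n * R ^ 2 / 16) ≤ ∑ i, cappedLog (F θ i (y i))} ≤
      ENNReal.ofReal ((J + 1) * Real.exp (-(n * R ^ 2 / 2 ^ 18))) := by
  have hn0 : 0 < n := by rw [hn]; exact_mod_cast hι
  set δ : ℕ → ℝ := fun j => d * R / 2 ^ j with hδ
  have hδ2 : ∀ j, δ j = 2 * δ (j + 1) := fun j => by simp only [hδ, pow_succ]; field_simp
  have hδ0 : ∀ j, 0 < δ j := fun j => by positivity
  have hδR : δ 0 ≤ R := by simp only [hδ, pow_zero, div_one]; nlinarith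
  set x : ℝ := n * R ^ 2 / 2 ^ 18 with hx
  have hx0 : 0 ≤ x := by positivity
  set S : ℕ → ℝ := fun j => ∑ i ∈ Finset.range (j + 2), H i with hS
  have hS0 : ∀ j, 0 ≤ S j := fun j => Finset.sum_nonneg fun i _ => hH i
  -- For a link j → j + 1 this choice gives t²/(2nδ_j²) = 2(S_j + x), which beats the union-bound
  -- entropy S_j and leaves a probability of at most e^{-x}.
  set t : ℕ → ℝ := fun j => Nat.casesOn j (n * R ^ 2 / 64) (fun j => 2 * δ j * √n * √(S j + x))
    with ht
  have ht0 : t 0 = n * R ^ 2 / 64 := rfl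
  have hts : ∀ j, t (j + 1) = 2 * δ j * √n * √(S j + x) := fun j => rfl
  have htn : ∀ j, 0 ≤ t j := by
    intro j
    cases j with
    | zero => rw [ht0]; positivity
    | succ j => rw [hts]; have := hδ0 j; positivity
  have hsn : √n * √n = n := Real.mul_self_sqrt hn0.le
  have hsx : √x = √n * R / 2 ^ 9 := by
    rw [Real.sqrt_eq_iff_mul_self_eq hx0 (by positivity), hx]
    linear_combination (-R ^ 2 / 2 ^ 18) * hsn
  have hsum : ∑ j ∈ Finset.range (J + 1), t j ≤ n * R ^ 2 / 32 := by
    rw [Finset.sum_range_succ', ht0]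
    have h1 : ∑ j ∈ Finset.range J, t (j + 1) ≤ 2 * √n *
        (∑ j ∈ Finset.range J, δ j * ∑ i ∈ Finset.range (j + 2), √(H i) +
          √x * ∑ j ∈ Finset.range J, δ j) := by
      rw [Finset.mul_sum, ← Finset.sum_add_distrib, Finset.mul_sum]
      refine Finset.sum_le_sum fun j _ => ?_
      rw [hts]
      have e1 : √(S j + x) ≤ ∑ i ∈ Finset.range (j + 2), √(H i) + √x :=
        (sqrt_add_le_add_sqrt (hS0 j) hx0).trans (by
          have := sqrt_sum_range_le hH (j + 2)
          simp only [hS]; linarith)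
      have e2 := mul_le_mul_of_nonneg_left e1
        (show 0 ≤ 2 * δ j * √n by have := hδ0 j; positivity)
      linarith
    have h2 := sum_halving_mul_partial_sum_le hδ2 (fun j => (hδ0 j).le)
      (fun j => Real.sqrt_nonneg (H j)) J
    have h3 := sum_halving_le hδ2 (fun j => (hδ0 j).le) J
    have h4 : √x * ∑ j ∈ Finset.range J, δ j ≤ √n * R / 2 ^ 9 * (2 * R) := by
      rw [hsx]
      exact mul_le_mul_of_nonneg_left (h3.trans (by linarith)) (by positivity)
    have h5 : d / 2 ^ 10 * √n * R ^ 2 ≤ 1 / 2 ^ 10 * √n * R ^ 2 := by gcongr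
    have h6 : ∑ j ∈ Finset.range J, δ j * ∑ i ∈ Finset.range (j + 2), √(H i) +
          √x * ∑ j ∈ Finset.range J, δ j ≤ √n * R ^ 2 / 128 := by
      have : 4 * ∑ j ∈ Finset.range (J + 1), δ j * √(H j) ≤ 4 * (1 / 2 ^ 10 * √n * R ^ 2) := by
        linarith
      nlinarith
    have h7 := mul_le_mul_of_nonneg_left h6 (show 0 ≤ 2 * √n by positivity)
    have h8 : 2 * √n * (√n * R ^ 2 / 128) = n * R ^ 2 / 64 := by
      linear_combination (R ^ 2 / 64) * hsn
    linarith
  -- With l = 1/512 the level 0 exponent is at most nR²(2⁻²⁰ + 2⁻¹⁶ - 2⁻¹⁵), which is below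
  -- -nR²/2¹⁸.
  have hmain := measure_chaining_le μ hU hFm s h hF hUF ha hδ0 hι (by rw [← hn]; exact hb) hN
    (l := 1 / 512) (by norm_num) (by norm_num) htn J
  rw [← hn] at hmain
  refine (measure_mono ?_).trans (hmain.trans ?_)
  -- In units of nR²/64: mean at most -8, bias at most 1, thresholds at most 2, and -5 is below the
  -- required -4.
  · rintro y ⟨θ, hθ⟩
    refine ⟨θ, le_trans ?_ hθ⟩
    have e1 := hmean θ
    have e2 : n * δ J ≤ n * (R ^ 2 / 64) := mul_le_mul_of_nonneg_left hJ hn0.le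
    have e3 : 0 ≤ n * R ^ 2 := by positivity
    linarith
  · have hH0 : H 0 ≤ n * R ^ 2 / 2 ^ 20 := by
      have e1 : d * R / 2 ^ 0 * √(H 0) ≤ d / 2 ^ 10 * √n * R ^ 2 :=
        (Finset.single_le_sum (f := fun j => d * R / 2 ^ j * √(H j))
          (fun j _ => by positivity) (Finset.mem_range.2 (Nat.succ_pos J))).trans hent
      have e2 : √(H 0) ≤ √n * R / 2 ^ 10 := by
        have : (d * R) * √(H 0) ≤ (d * R) * (√n * R / 2 ^ 10) := by
          calc _ = d * R / 2 ^ 0 * √(H 0) := by simp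
            _ ≤ _ := e1
            _ = _ := by ring
        exact le_of_mul_le_mul_left this (by positivity)
      have e3 : √(H 0) * √(H 0) ≤ (√n * R / 2 ^ 10) * (√n * R / 2 ^ 10) := by gcongr
      rw [Real.mul_self_sqrt (hH 0)] at e3
      calc _ ≤ _ := e3
        _ = _ := by linear_combination (R ^ 2 / 2 ^ 20) * hsn
    rw [add_mul, one_mul, ENNReal.ofReal_add (by positivity) (by positivity), add_comm]
    refine add_le_add ?_ (ENNReal.ofReal_le_ofReal (Real.exp_le_exp.2 ?_))
    · rw [ENNReal.ofReal_mul (by positivity), ENNReal.ofReal_natCast, ← nsmul_eq_mul]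
      conv_rhs => rw [← Finset.card_range J, ← Finset.sum_const]
      refine Finset.sum_le_sum fun j _ => ENNReal.ofReal_le_ofReal (Real.exp_le_exp.2 ?_)
      have hpos := hδ0 j
      have e : t (j + 1) ^ 2 / (2 * (n * δ j ^ 2)) = 2 * (S j + x) := by
        rw [hts, mul_pow, Real.sq_sqrt (add_nonneg (hS0 j) hx0), mul_pow, Real.sq_sqrt hn0.le]
        field_simp
      rw [e]
      have := hS0 j
      simp only [hS] at this ⊢
      linarith
    · rw [ht0]
      have e : n * δ 0 ^ 2 ≤ n * R ^ 2 :=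
        mul_le_mul_of_nonneg_left (pow_le_pow_left₀ (hδ0 0).le hδR 2) hn0.le
      have e3 : 0 ≤ n * R ^ 2 := by positivity
      linarith

/-! ### From likelihood ratios to root density ratios. -/

section Translation

variable {Θ : Type u} [MeasurableSpace Θ] {m : ℕ} (E : Experiment.{u, v} Θ m)

lemma Experiment.measurable_density (i : Fin m) (θ : Θ) : Measurable (E.p i θ) :=
  (E.measurable_p i).comp measurable_prodMk_left

instance (θ : Θ) (i : Fin m) : IsProbabilityMeasure (E.law θ i) := by
  constructor
  rw [Experiment.law, withDensity_apply _ MeasurableSet.univ, Measure.restrict_univ,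
    E.lintegral_p]

instance (θ : Θ) : IsProbabilityMeasure (E.jointLaw θ) := by
  unfold Experiment.jointLaw; infer_instance

lemma Experiment.integrable_density (i : Fin m) (θ : Θ) : Integrable (E.p i θ) (E.ν i) := by
  refine ⟨(E.measurable_density i θ).aestronglyMeasurable, ?_⟩
  rw [hasFiniteIntegral_iff_ofReal (ae_of_all _ (E.nonneg_p i θ)), E.lintegral_p]
  exact ENNReal.one_lt_top

lemma Experiment.integral_density (i : Fin m) (θ : Θ) : ∫ y, E.p i θ y ∂(E.ν i) = 1 := by
  rw [integral_eq_lintegral_of_nonneg_ae (ae_of_all _ (E.nonneg_p i θ))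
    (E.measurable_density i θ).aestronglyMeasurable, E.lintegral_p, ENNReal.toReal_one]

lemma Experiment.lintegral_law (θ : Θ) (i : Fin m) {f : E.Obs i → ℝ≥0∞} (hf : Measurable f) :
    ∫⁻ y, f y ∂(E.law θ i) = ∫⁻ y, ENNReal.ofReal (E.p i θ y) * f y ∂(E.ν i) := by
  rw [Experiment.law, lintegral_withDensity_eq_lintegral_mul _
    (E.measurable_density i θ).ennreal_ofReal hf]
  rfl

lemma Experiment.ae_density_pos (θ : Θ) (i : Fin m) : ∀ᵐ y ∂(E.law θ i), 0 < E.p i θ y := by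
  rw [Experiment.law, ae_withDensity_iff (E.measurable_density i θ).ennreal_ofReal]
  refine ae_of_all _ fun y hy => ?_
  simpa using hy

lemma Experiment.ae_forall_density_pos (θ : Θ) :
    ∀ᵐ y ∂(E.jointLaw θ), ∀ i, 0 < E.p i θ (y i) := by
  rw [ae_all_iff]
  intro i
  exact (measurePreserving_eval (E.law θ) i).quasiMeasurePreserving.ae (E.ae_density_pos θ i)

lemma Experiment.integrable_sub_sq (i : Fin m) (θ θ' : Θ) :
    Integrable (fun y => (√(E.p i θ y) - √(E.p i θ' y)) ^ 2) (E.ν i) := by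
  have m1 := E.measurable_density i θ
  have m2 := E.measurable_density i θ'
  refine (((E.integrable_density i θ).const_mul 2).add
    ((E.integrable_density i θ').const_mul 2)).mono (by fun_prop) (ae_of_all _ fun y => ?_)
  have h1 := E.nonneg_p i θ y
  have h2 := E.nonneg_p i θ' y
  simp only [Pi.add_apply, Real.norm_eq_abs]
  rw [abs_of_nonneg (sq_nonneg _), abs_of_nonneg (by positivity)]
  nlinarith [Real.sq_sqrt h1, Real.sq_sqrt h2, sq_nonneg (√(E.p i θ y) + √(E.p i θ' y))]

lemma hellinger_sq {Y : Type v} [MeasurableSpace Y] (ν : Measure Y) (f g : Y → ℝ) :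
    hellinger ν f g ^ 2 = ∫ y, (√(f y) - √(g y)) ^ 2 ∂ν :=
  Real.sq_sqrt (integral_nonneg fun _ => sq_nonneg _)

lemma Experiment.sum_hellinger_sq (hm : 0 < m) (θ θ' : Θ) :
    ∑ i, hellinger (E.ν i) (E.p i θ) (E.p i θ') ^ 2 = m * E.pseudoHellinger θ θ' ^ 2 := by
  have : (m : ℝ) ≠ 0 := by exact_mod_cast hm.ne'
  rw [Experiment.pseudoHellinger, Real.sq_sqrt (by positivity)]
  field_simp

/-- The density of the law cancels the denominator; mass where p_{θ₀} vanishes is lost, hence only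
an inequality. -/
lemma Experiment.lintegral_div_sqrt_sq_le (θ₀ : Θ) (i : Fin m) {a : E.Obs i → ℝ}
    (ha : Measurable a) :
    ∫⁻ y, ENNReal.ofReal ((a y / √(E.p i θ₀ y)) ^ 2) ∂(E.law θ₀ i) ≤
      ∫⁻ y, ENNReal.ofReal (a y ^ 2) ∂(E.ν i) := by
  have m1 := E.measurable_density i θ₀
  rw [E.lintegral_law θ₀ i (by fun_prop)]
  refine lintegral_mono fun y => ?_
  rw [← ENNReal.ofReal_mul (E.nonneg_p i θ₀ y)]
  refine ENNReal.ofReal_le_ofReal ?_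
  rw [div_pow, Real.sq_sqrt (E.nonneg_p i θ₀ y)]
  rcases (E.nonneg_p i θ₀ y).eq_or_lt with h | h
  · rw [← h]; simp [sq_nonneg]
  · rw [mul_div_cancel₀ _ h.ne']

lemma memLp_two_of_lintegral_sq_ne_top {Y : Type*} [MeasurableSpace Y] {μ : Measure Y} {a : Y → ℝ}
    (ha : Measurable a) (h : ∫⁻ y, ENNReal.ofReal (a y ^ 2) ∂μ ≠ ⊤) : MemLp a 2 μ := by
  rw [memLp_two_iff_integrable_sq ha.aestronglyMeasurable]
  refine ⟨(ha.pow_const 2).aestronglyMeasurable, ?_⟩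
  rw [hasFiniteIntegral_iff_ofReal (ae_of_all _ fun _ => sq_nonneg _)]
  exact h.lt_top

lemma ofReal_integral_sq {Y : Type*} [MeasurableSpace Y] {μ : Measure Y} {a : Y → ℝ}
    (ha : MemLp a 2 μ) :
    ENNReal.ofReal (∫ y, a y ^ 2 ∂μ) = ∫⁻ y, ENNReal.ofReal (a y ^ 2) ∂μ :=
  ofReal_integral_eq_lintegral_ofReal ha.integrable_sq (ae_of_all _ fun _ => sq_nonneg _)

/-- The root density ratio `√(p_i(y | θ) / p_i(y | θ₀))`. -/
noncomputable def Experiment.rootRatio (θ₀ θ : Θ) (i : Fin m) (y : E.Obs i) : ℝ :=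
  √(E.p i θ y) / √(E.p i θ₀ y)

lemma Experiment.measurable_rootRatio (θ₀ θ : Θ) (i : Fin m) :
    Measurable (E.rootRatio θ₀ θ i) := by
  have m1 := E.measurable_density i θ₀
  have m2 := E.measurable_density i θ
  unfold Experiment.rootRatio; fun_prop

lemma Experiment.rootRatio_sub_one_ae (θ₀ θ : Θ) (i : Fin m) :
    ∀ᵐ y ∂(E.law θ₀ i), E.rootRatio θ₀ θ i y - 1 =
      (√(E.p i θ y) - √(E.p i θ₀ y)) / √(E.p i θ₀ y) := by
  filter_upwards [E.ae_density_pos θ₀ i] with y hy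
  rw [Experiment.rootRatio, sub_div, div_self (Real.sqrt_pos.2 hy).ne']

lemma Experiment.lintegral_rootRatio_sub_one_sq_le (θ₀ θ : Θ) (i : Fin m) :
    ∫⁻ y, ENNReal.ofReal ((E.rootRatio θ₀ θ i y - 1) ^ 2) ∂(E.law θ₀ i) ≤
      ENNReal.ofReal (hellinger (E.ν i) (E.p i θ) (E.p i θ₀) ^ 2) := by
  have m1 := E.measurable_density i θ₀
  have m2 := E.measurable_density i θ
  rw [hellinger_sq, ofReal_integral_eq_lintegral_ofReal (E.integrable_sub_sq i θ θ₀)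
    (ae_of_all _ fun y => sq_nonneg _)]
  refine le_trans (le_of_eq (lintegral_congr_ae ?_))
    (E.lintegral_div_sqrt_sq_le θ₀ i (a := fun y => √(E.p i θ y) - √(E.p i θ₀ y)) (by fun_prop))
  filter_upwards [E.rootRatio_sub_one_ae θ₀ θ i] with y hy
  rw [hy]

lemma Experiment.memLp_rootRatio_sub_one (θ₀ θ : Θ) (i : Fin m) :
    MemLp (fun y => E.rootRatio θ₀ θ i y - 1) 2 (E.law θ₀ i) :=
  memLp_two_of_lintegral_sq_ne_top ((E.measurable_rootRatio θ₀ θ i).sub_const 1)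
    ((E.lintegral_rootRatio_sub_one_sq_le θ₀ θ i).trans_lt ENNReal.ofReal_lt_top).ne

lemma Experiment.integral_rootRatio_sub_one_sq_le (θ₀ θ : Θ) (i : Fin m) :
    ∫ y, (E.rootRatio θ₀ θ i y - 1) ^ 2 ∂(E.law θ₀ i) ≤
      hellinger (E.ν i) (E.p i θ) (E.p i θ₀) ^ 2 := by
  rw [← ENNReal.ofReal_le_ofReal_iff (sq_nonneg _),
    ofReal_integral_sq (E.memLp_rootRatio_sub_one θ₀ θ i)]
  exact E.lintegral_rootRatio_sub_one_sq_le θ₀ θ i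

/-- √p₀(√p - √p₀) = (p - p₀)/2 - (√p - √p₀)²/2, and both densities integrate to 1. This is the
negative drift that drives the shell estimate. -/
lemma Experiment.integral_rootRatio_sub_one (θ₀ θ : Θ) (i : Fin m) :
    ∫ y, (E.rootRatio θ₀ θ i y - 1) ∂(E.law θ₀ i) =
      -(hellinger (E.ν i) (E.p i θ) (E.p i θ₀) ^ 2 / 2) := by
  have m1 := E.measurable_density i θ₀
  rw [integral_congr_ae (E.rootRatio_sub_one_ae θ₀ θ i), Experiment.law,
    integral_withDensity_eq_integral_toReal_smul m1.ennreal_ofReal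
      (ae_of_all _ fun y => ENNReal.ofReal_lt_top), hellinger_sq]
  have i1 := E.integrable_density i θ
  have i2 := E.integrable_density i θ₀
  have i3 := E.integrable_sub_sq i θ θ₀
  have e : ∀ y, (ENNReal.ofReal (E.p i θ₀ y)).toReal •
      ((√(E.p i θ y) - √(E.p i θ₀ y)) / √(E.p i θ₀ y)) =
      1 / 2 * (E.p i θ y - E.p i θ₀ y) - 1 / 2 * (√(E.p i θ y) - √(E.p i θ₀ y)) ^ 2 := by
    intro y
    have h1 := E.nonneg_p i θ y
    have h2 := E.nonneg_p i θ₀ y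
    rw [ENNReal.toReal_ofReal h2, smul_eq_mul]
    have s1 := Real.sq_sqrt h1
    have s2 := Real.sq_sqrt h2
    have : E.p i θ₀ y * ((√(E.p i θ y) - √(E.p i θ₀ y)) / √(E.p i θ₀ y)) =
        √(E.p i θ₀ y) * (√(E.p i θ y) - √(E.p i θ₀ y)) := by
      rcases h2.eq_or_lt with h | h
      · rw [← h]; simp
      · have := Real.sqrt_pos.2 h
        field_simp
        rw [s2]
    rw [this]
    linear_combination (1 / 2) * s1 - (1 / 2) * s2
  simp_rw [e]
  have i12 : Integrable (fun y => E.p i θ y - E.p i θ₀ y) (E.ν i) := i1.sub i2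
  rw [integral_sub (i12.const_mul _) (i3.const_mul _), integral_const_mul,
    integral_const_mul, integral_sub i1 i2, E.integral_density, E.integral_density]
  ring

/-- A finite bracketing of cardinality at most `exp b` from a bound `b` on the entropy. -/
lemma Experiment.exists_isBracketing {δ b : ℝ} {Ξ : Set Θ}
    (h : E.bracketingEntropy δ Ξ ≤ (b : EReal)) :
    ∃ N : ℕ, (N : ℝ) ≤ Real.exp b ∧ ∃ l u, E.IsBracketing δ Ξ N l u := by
  have h1 : 1 + (E.bracketingNumber δ Ξ : ℝ≥0∞) ≤ ENNReal.ofReal (Real.exp b) := by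
    have := EReal.exp_le_exp_iff.2 h
    rwa [Experiment.bracketingEntropy, ENNReal.exp_log, EReal.exp_coe] at this
  have htop : E.bracketingNumber δ Ξ ≠ ⊤ := by
    intro ht
    rw [ht] at h1
    simp at h1
  obtain ⟨n, hn⟩ := ENat.ne_top_iff_exists.1 htop
  have h2 : E.bracketingNumber δ Ξ < ((n + 1 : ℕ) : ℕ∞) := by
    rw [← hn]; exact_mod_cast Nat.lt_succ_self n
  rw [Experiment.bracketingNumber] at h2
  simp only [iInf_lt_iff] at h2
  obtain ⟨N, hN, hlt⟩ := h2
  refine ⟨N, ?_, hN⟩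
  have hNn : N ≤ n := by
    have : N < n + 1 := by exact_mod_cast hlt
    omega
  rw [← hn] at h1
  have h3 : ENNReal.ofReal (1 + n) ≤ ENNReal.ofReal (Real.exp b) := by
    refine le_trans (le_of_eq ?_) h1
    rw [ENNReal.ofReal_add zero_le_one (Nat.cast_nonneg _)]
    simp
  have h4 := (ENNReal.ofReal_le_ofReal_iff (Real.exp_pos b).le).1 h3
  have h5 : (N : ℝ) ≤ n := by exact_mod_cast hNn
  linarith

lemma Experiment.prod_density_le {θ₀ θ : Θ} {y : ∀ i, E.Obs i} (hy : ∀ i, 0 < E.p i θ₀ (y i)) :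
    ∏ i, E.p i θ (y i) ≤
      Real.exp (2 * ∑ i, cappedLog (E.rootRatio θ₀ θ i (y i))) * ∏ i, E.p i θ₀ (y i) := by
  rw [Finset.mul_sum, Real.exp_sum, ← Finset.prod_mul_distrib]
  refine Finset.prod_le_prod (fun i _ => E.nonneg_p i θ _) fun i _ => ?_
  have h1 := self_le_exp_cappedLog (E.rootRatio θ₀ θ i (y i))
  have h0 : 0 ≤ E.rootRatio θ₀ θ i (y i) := by unfold Experiment.rootRatio; positivity
  have h2 := pow_le_pow_left₀ h0 h1 2
  rw [← Real.exp_nat_mul] at h2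
  have h3 : E.rootRatio θ₀ θ i (y i) ^ 2 * E.p i θ₀ (y i) = E.p i θ (y i) := by
    rw [Experiment.rootRatio, div_pow, Real.sq_sqrt (E.nonneg_p _ _ _),
      Real.sq_sqrt (hy i).le, div_mul_cancel₀ _ (hy i).ne']
  rw [← h3]
  exact mul_le_mul_of_nonneg_right (by exact_mod_cast h2) (hy i).le

/-- Uniform exponential smallness of the likelihood ratios on a Hellinger shell around `θ₀`. -/
theorem Experiment.measure_likelihood_shell_le (hm : 0 < m) (θ₀ : Θ) {R d : ℝ} (hR : 0 < R)
    (hd : 0 < d) (hd1 : d ≤ 1) {H : ℕ → ℝ} (hH : ∀ j, 0 ≤ H j)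
    (hent : ∀ j, E.bracketingEntropy (d * R / 2 ^ j) {θ | E.pseudoHellinger θ θ₀ ≤ R} ≤
      (H j : EReal)) {J : ℕ} (hJ : d * R / 2 ^ J ≤ R ^ 2 / 64)
    (hsum : ∑ j ∈ Finset.range (J + 1), d * R / 2 ^ j * √(H j) ≤ d / 2 ^ 10 * √m * R ^ 2) :
    E.jointLaw θ₀ {y | ∃ θ, R / 2 ≤ E.pseudoHellinger θ θ₀ ∧ E.pseudoHellinger θ θ₀ ≤ R ∧
      Real.exp (-(m * R ^ 2 / 8)) * ∏ i, E.p i θ₀ (y i) < ∏ i, E.p i θ (y i)} ≤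
      ENNReal.ofReal ((J + 1) * Real.exp (-(m * R ^ 2 / 2 ^ 18))) := by
  choose N hN l u hlu using fun j => E.exists_isBracketing (hent j)
  let T := {θ : Θ // R / 2 ≤ E.pseudoHellinger θ θ₀ ∧ E.pseudoHellinger θ θ₀ ≤ R}
  choose s hs using fun (j : ℕ) (θ : T) => (hlu j).2 θ.1 θ.2.2
  have hm0 : (0 : ℝ) < m := by exact_mod_cast hm
  have mp := E.measurable_density
  have mu : ∀ j s i, Measurable (u j s i) := fun j s i => ((hlu j).1 s i).2.1
  have ml : ∀ j s i, Measurable (l j s i) := fun j s i => ((hlu j).1 s i).1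
  set U : ∀ j, Fin (N j) → ∀ i, E.Obs i → ℝ := fun j s i y => √(u j s i y) / √(E.p i θ₀ y)
    with hU
  have hUm : ∀ j s i, Measurable (U j s i) := fun j s i => by
    have := mu j s i; have := mp i θ₀
    simp only [hU]; fun_prop
  -- Since l ≤ p ≤ u, √u - √p ≤ √u - √l: dividing the root brackets by √p₀ gives upper brackets of
  -- the same width for the root ratio.
  have hw : ∀ (j : ℕ) (θ : T),
      ∑ i, ∫⁻ y, ENNReal.ofReal ((U j (s j θ) i y - E.rootRatio θ₀ θ i y) ^ 2) ∂(E.law θ₀ i) ≤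
        ENNReal.ofReal (m * (d * R / 2 ^ j) ^ 2) := by
    intro j θ
    have h1 := (hs j θ).2
    rw [ENNReal.inv_mul_le_iff (by exact_mod_cast hm.ne') (ENNReal.natCast_ne_top m),
      ← ENNReal.ofReal_natCast, ← ENNReal.ofReal_mul (Nat.cast_nonneg m)] at h1
    refine le_trans (Finset.sum_le_sum fun i _ => ?_) h1
    have m1 := mu j (s j θ) i
    have m2 := mp i θ.1
    calc _ = ∫⁻ y, ENNReal.ofReal (((√(u j (s j θ) i y) - √(E.p i θ.1 y)) /
          √(E.p i θ₀ y)) ^ 2) ∂(E.law θ₀ i) := by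
          simp only [hU, Experiment.rootRatio, sub_div]
      _ ≤ ∫⁻ y, ENNReal.ofReal ((√(u j (s j θ) i y) - √(E.p i θ.1 y)) ^ 2) ∂(E.ν i) :=
          E.lintegral_div_sqrt_sq_le θ₀ i (by fun_prop)
      _ ≤ _ := by
          refine lintegral_mono fun y => ENNReal.ofReal_le_ofReal ?_
          have h2 := Real.sqrt_le_sqrt ((hs j θ).1 i y).1
          have h3 := Real.sqrt_le_sqrt ((hs j θ).1 i y).2
          exact pow_le_pow_left₀ (by linarith) (by linarith) 2
  have hUF : ∀ (θ : T) j i,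
      MemLp (fun y => U j (s j θ) i y - E.rootRatio θ₀ θ i y) 2 (E.law θ₀ i) := fun θ j i =>
    memLp_two_of_lintegral_sq_ne_top ((hUm j _ i).sub (E.measurable_rootRatio θ₀ θ.1 i))
      (((Finset.single_le_sum (f := fun i => ∫⁻ y, ENNReal.ofReal
        ((U j (s j θ) i y - E.rootRatio θ₀ θ i y) ^ 2) ∂(E.law θ₀ i))
        (fun _ _ => zero_le) (Finset.mem_univ i)).trans (hw j θ)).trans_lt
        ENNReal.ofReal_lt_top).ne
  have key := measure_chaining_dyadic_le (E.law θ₀) hUm (T := T)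
    (F := fun θ => E.rootRatio θ₀ θ.1) (fun θ i => E.measurable_rootRatio θ₀ θ.1 i) s
    (fun θ j i y => by
      simp only [hU, Experiment.rootRatio]
      exact div_le_div_of_nonneg_right (Real.sqrt_le_sqrt ((hs j θ).1 i y).2)
        (Real.sqrt_nonneg _))
    (fun θ i => E.memLp_rootRatio_sub_one θ₀ θ.1 i) hUF (by simpa using hm) (n := m)
    (by simp) hR hd hd1
    (fun θ => by
      refine (Finset.sum_le_sum fun i _ => E.integral_rootRatio_sub_one_sq_le θ₀ θ.1 i).trans ?_
      rw [E.sum_hellinger_sq hm]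
      have : 0 ≤ E.pseudoHellinger θ.1 θ₀ := Real.sqrt_nonneg _
      have := θ.2.2
      gcongr)
    (fun θ => by
      simp_rw [E.integral_rootRatio_sub_one θ₀ θ.1]
      rw [Finset.sum_neg_distrib, ← Finset.sum_div, E.sum_hellinger_sq hm]
      have h1 := pow_le_pow_left₀ (by positivity) θ.2.1 2
      have h2 := mul_le_mul_of_nonneg_left h1 hm0.le
      linarith)
    (fun θ j => by
      rw [← ENNReal.ofReal_le_ofReal_iff (by positivity), ENNReal.ofReal_sum_of_nonneg
        fun i _ => integral_nonneg fun _ => sq_nonneg _]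
      simp_rw [ofReal_integral_sq (hUF θ j _)]
      exact hw j θ)
    hH hN hJ hsum
  -- The inclusion holds only where p₀ > 0. The rate mR²/8 becomes mR²/16 since the likelihood ratio
  -- is the square of the product of root ratios.
  refine le_trans (measure_mono_ae ?_) key
  filter_upwards [E.ae_forall_density_pos θ₀] with y hy
  rintro ⟨θ, h1, h2, h3⟩
  refine ⟨⟨θ, h1, h2⟩, ?_⟩
  by_contra hlt
  rw [not_le] at hlt
  have h4 := E.prod_density_le (θ := θ) hy
  have h5 : Real.exp (2 * ∑ i, cappedLog (E.rootRatio θ₀ θ i (y i))) ≤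
      Real.exp (-(m * R ^ 2 / 8)) := Real.exp_le_exp.2 (by linarith)
  have h6 : 0 ≤ ∏ i, E.p i θ₀ (y i) := Finset.prod_nonneg fun i _ => E.nonneg_p _ _ _
  have h7 := mul_le_mul_of_nonneg_right h5 h6
  linarith

lemma Experiment.pseudoHellinger_sq_le_two (hm : 0 < m) (θ θ' : Θ) :
    E.pseudoHellinger θ θ' ^ 2 ≤ 2 := by
  have hm0 : (0 : ℝ) < m := by exact_mod_cast hm
  have h1 : ∑ i, hellinger (E.ν i) (E.p i θ) (E.p i θ') ^ 2 ≤ ∑ _i : Fin m, (2 : ℝ) := by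
    refine Finset.sum_le_sum fun i _ => ?_
    rw [hellinger_sq]
    have i1 := E.integrable_density i θ
    have i2 := E.integrable_density i θ'
    calc _ ≤ ∫ y, (E.p i θ y + E.p i θ' y) ∂(E.ν i) := by
          refine integral_mono (E.integrable_sub_sq i θ θ') (i1.add i2) fun y => ?_
          have h1 := Real.sq_sqrt (E.nonneg_p i θ y)
          have h2 := Real.sq_sqrt (E.nonneg_p i θ' y)
          simp only
          nlinarith [mul_nonneg (Real.sqrt_nonneg (E.p i θ y)) (Real.sqrt_nonneg (E.p i θ' y))]
      _ = 2 := by rw [integral_add i1 i2, E.integral_density, E.integral_density]; norm_num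
  rw [E.sum_hellinger_sq hm, Finset.sum_const, Finset.card_univ, Fintype.card_fin,
    nsmul_eq_mul] at h1
  exact le_of_mul_le_mul_left h1 hm0

end Translation

/-! ### Entropy integrals and Hellinger shells. -/

section Shells

/-- Comparison of a dyadic sum with the integral of a nonincreasing function. -/
lemma sum_dyadic_mul_le_integral {q : ℝ → ℝ} (hq : AntitoneOn q (Set.Ioi 0)) {b : ℝ} (hb : 0 < b)
    (J : ℕ) :
    ∑ j ∈ Finset.range (J + 1), b / 2 ^ j * q (b / 2 ^ j) ≤
      2 * ∫ u in (b / 2 ^ (J + 1))..b, q u := by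
  have hint : ∀ x y : ℝ, 0 < x → 0 < y → IntervalIntegrable q volume x y := fun x y hx hy =>
    (hq.mono fun z hz => lt_of_lt_of_le (lt_min hx hy) hz.1).intervalIntegrable
  have hstep : ∀ x : ℝ, 0 < x → x * q x ≤ 2 * ∫ u in (x / 2)..x, q u := by
    intro x hx
    have h1 : ∫ _u in (x / 2)..x, q x ≤ ∫ u in (x / 2)..x, q u := by
      refine intervalIntegral.integral_mono_on (by linarith) (by simp)
        (hint _ _ (by linarith) hx) fun u hu => ?_
      exact hq (show 0 < u by linarith [hu.1]) hx hu.2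
    rw [intervalIntegral.integral_const, smul_eq_mul] at h1
    linarith
  have hpos : ∀ j : ℕ, 0 < b / 2 ^ j := fun j => by positivity
  induction J with
  | zero => simpa using hstep b hb
  | succ J ih =>
    rw [Finset.sum_range_succ]
    have h1 := hstep _ (hpos (J + 1))
    have e : b / 2 ^ (J + 1) / 2 = b / 2 ^ (J + 1 + 1) := by rw [pow_succ _ (J + 1)]; field_simp
    rw [e] at h1
    have h2 := intervalIntegral.integral_add_adjacent_intervals
      (hint _ _ (hpos (J + 1 + 1)) (hpos (J + 1))) (hint _ _ (hpos (J + 1)) hb)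
    linarith

/-- The three bounds serve, in order, to make the final bracket width at most R²/64, to keep the
dyadic sum inside the range of the entropy integral, and to bound the number of chaining events. -/
lemma exists_dyadic_level {R : ℝ} (hR : 0 < R) (hR4 : R ≤ 4) :
    ∃ J : ℕ, 64 / R ≤ 2 ^ J ∧ (2 : ℝ) ^ J ≤ 2 ^ 11 / R ∧ (J + 1 : ℝ) ≤ 2 ^ 11 / R := by
  obtain ⟨n, h1, h2⟩ := exists_nat_pow_near (x := 64 / R) (y := 2)
    (by rw [le_div_iff₀ hR]; linarith) (by norm_num)
  have h3 : (2 : ℝ) ^ (n + 1) ≤ 2 ^ 11 / R := by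
    rw [pow_succ]
    calc (2 : ℝ) ^ n * 2 ≤ 64 / R * 2 := by gcongr
      _ = 128 / R := by ring
      _ ≤ _ := by gcongr; norm_num
  refine ⟨n + 1, h2.le, h3, le_trans ?_ h3⟩
  have : n + 1 + 1 ≤ 2 ^ (n + 1) := Nat.lt_two_pow_self
  exact_mod_cast this

variable {Θ : Type u} [MeasurableSpace Θ] {k : ℕ → ℕ}

theorem EntropyCondition.eventually_measure_shell_le
    {E : ∀ m, Fin (k m) → Experiment.{u, v} Θ m} {θ₀ : Θ} {D₁ D₂ D₃ : ℝ}
    (hD₁ : 0 < D₁) (hD₁' : D₁ ≤ 1) (hD₃ : 0 < D₃)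
    (h : EntropyCondition E θ₀ D₁ D₂ D₃) {K : ℕ} (hK : 2 ≤ K) (hKD : 2 ^ 12 * D₂ ≤ K * D₁) :
    ∀ᶠ m : ℕ in atTop, ∀ (j : Fin (k m)) (R : ℝ), 0 < R → R ≤ 4 →
      K * D₃ * (Real.log m / √m) ≤ R →
      (E m j).jointLaw θ₀ {y | ∃ θ, R / 2 ≤ (E m j).pseudoHellinger θ θ₀ ∧
        (E m j).pseudoHellinger θ θ₀ ≤ R ∧ Real.exp (-(m * R ^ 2 / 8)) *
          ∏ i, (E m j).p i θ₀ (y i) < ∏ i, (E m j).p i θ (y i)} ≤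
      ENNReal.ofReal (2 ^ 11 / R * Real.exp (-(m * R ^ 2 / 2 ^ 18))) := by
  obtain ⟨Ψ, hΨ0, hΨu, -, hev⟩ := h
  obtain ⟨m₀, hm₀⟩ := eventually_atTop.1 hev
  have hK0 : (0 : ℝ) < K := by positivity
  filter_upwards [eventually_ge_atTop m₀, eventually_ge_atTop (m₀ * K ^ 2),
    eventually_ge_atTop (K ^ 2), eventually_ge_atTop 2] with m hm1 hm2 hm3 hm4 j R hR hR4 hKR
  have hm0 : (0 : ℝ) < m := by positivity
  have hK1 : (1 : ℝ) ≤ K := by exact_mod_cast (by omega : 1 ≤ K)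
  have hlog : 0 ≤ Real.log m / √m := by
    have : 0 ≤ Real.log m := Real.log_natCast_nonneg m
    positivity
  have hent : ∀ (j : Fin (k m)) (u : ℝ), 0 < u → (E m j).bracketingEntropy u
      {θ | (E m j).pseudoHellinger θ θ₀ ≤ R} ≤ (Ψ u R : EReal) := by
    refine (hm₀ m hm1 R hR (le_trans ?_ hKR)).1
    have : D₃ ≤ K * D₃ := by nlinarith
    exact mul_le_mul_of_nonneg_right this hlog
  -- As Ψ does not depend on the sample size, the integral condition is used at n ≈ m/K². Since K√n
  -- ≤ 2√m, the constant D₂ improves to 2D₂/K, while the smallest admissible radius grows by a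
  -- factor of at most K.
  set n : ℕ := m / K ^ 2 + 1 with hn
  have hKK : 0 < K ^ 2 := by positivity
  have hnm0 : m₀ ≤ n := by
    have : m₀ ≤ m / K ^ 2 := (Nat.le_div_iff_mul_le hKK).2 hm2
    omega
  have hnm : n ≤ m := by
    have h1 : m / K ^ 2 ≤ m / 4 := Nat.div_le_div_left (by nlinarith) (by norm_num)
    omega
  have hn_lb : (m : ℝ) ≤ K ^ 2 * n := by
    have : m < K ^ 2 * n := by
      rw [hn, mul_add, mul_one]
      have h1 := Nat.div_add_mod m (K ^ 2)
      have h2 := Nat.mod_lt m hKK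
      omega
    exact_mod_cast this.le
  have hn_ub : (K : ℝ) ^ 2 * n ≤ 4 * m := by
    have h1 := Nat.div_mul_le_self m (K ^ 2)
    have : K ^ 2 * n ≤ 4 * m := by
      rw [hn, mul_add, mul_one]
      nlinarith
    exact_mod_cast this
  have hs_lb : √m ≤ K * √n := by
    rw [← Real.sqrt_sq hK0.le, ← Real.sqrt_mul (by positivity)]
    exact Real.sqrt_le_sqrt hn_lb
  have hs_ub : K * √n ≤ 2 * √m := by
    have : √(K ^ 2 * n) ≤ √(2 ^ 2 * m) := Real.sqrt_le_sqrt (by linarith)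
    rwa [Real.sqrt_mul (by positivity), Real.sqrt_mul (by positivity), Real.sqrt_sq hK0.le,
      Real.sqrt_sq (by norm_num)] at this
  have hn0 : (0 : ℝ) < n := by rw [hn]; positivity
  have hint := (hm₀ n hnm0 R hR (le_trans (by
    have h1 : Real.log n ≤ Real.log m := Real.log_le_log hn0 (by exact_mod_cast hnm)
    have h0 : 0 ≤ Real.log m := Real.log_natCast_nonneg m
    have h2 : Real.log n / √n ≤ K * (Real.log m / √m) := by
      rw [div_le_iff₀ (Real.sqrt_pos.2 hn0)]
      calc Real.log n ≤ Real.log m := h1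
        _ = Real.log m / √m * √m := by rw [div_mul_cancel₀ _ (Real.sqrt_pos.2 hm0).ne']
        _ ≤ Real.log m / √m * (K * √n) := mul_le_mul_of_nonneg_left hs_lb hlog
        _ = _ := by ring
    have := mul_le_mul_of_nonneg_left h2 hD₃.le
    linarith) hKR)).2
  obtain ⟨J, hJ1, hJ2, hJ3⟩ := exists_dyadic_level hR hR4
  have h2J : (0 : ℝ) < 2 ^ J := by positivity
  have hqa : AntitoneOn (fun u => √(Ψ u R)) (Set.Ioi 0) := fun x hx y hy hxy =>
    Real.sqrt_le_sqrt (hΨu R hR hx hy hxy)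
  have hDR : 0 < D₁ * R := by positivity
  have hlow : D₁ * R ^ 2 / 2 ^ 12 ≤ D₁ * R / 2 ^ (J + 1) := by
    rw [div_le_div_iff₀ (by norm_num) (by positivity), pow_succ 2 J]
    rw [le_div_iff₀ hR] at hJ2
    nlinarith [mul_le_mul_of_nonneg_left hJ2 hDR.le]
  have hup : D₁ * R / 2 ^ (J + 1) ≤ D₁ * R := div_le_self hDR.le (one_le_pow₀ (by norm_num))
  have hI : ∫ u in (D₁ * R / 2 ^ (J + 1))..(D₁ * R), √(Ψ u R) ≤
      ∫ u in (D₁ * R ^ 2 / 2 ^ 12)..(D₁ * R), √(Ψ u R) := by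
    refine intervalIntegral.integral_mono_interval hlow hup le_rfl
      (ae_of_all _ fun u => Real.sqrt_nonneg _) ?_
    refine (hqa.mono fun z hz => lt_of_lt_of_le (lt_min ?_ hDR) hz.1).intervalIntegrable
    positivity
  have hsum := sum_dyadic_mul_le_integral hqa hDR J
  have hsum' : ∑ j ∈ Finset.range (J + 1), D₁ * R / 2 ^ j * √(Ψ (D₁ * R / 2 ^ j) R) ≤
      D₁ / 2 ^ 10 * √m * R ^ 2 := by
    have h1 : ∑ j ∈ Finset.range (J + 1), D₁ * R / 2 ^ j * √(Ψ (D₁ * R / 2 ^ j) R) ≤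
        2 * (D₂ * √n * R ^ 2) := hsum.trans (by linarith)
    have h2 : 2 ^ 12 * D₂ * √n ≤ K * D₁ * √n :=
      mul_le_mul_of_nonneg_right hKD (Real.sqrt_nonneg _)
    have h3 : K * D₁ * √n ≤ D₁ * (2 * √m) := by
      calc _ = D₁ * (K * √n) := by ring
        _ ≤ _ := mul_le_mul_of_nonneg_left hs_ub hD₁.le
    have h4 : 2 * (D₂ * √n) ≤ D₁ / 2 ^ 10 * √m := by linarith
    calc _ ≤ _ := h1
      _ = 2 * (D₂ * √n) * R ^ 2 := by ring
      _ ≤ _ := by gcongr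
  refine ((E m j).measure_likelihood_shell_le (by omega) θ₀ hR hD₁ hD₁'
    (H := fun i => Ψ (D₁ * R / 2 ^ i) R) (fun i => hΨ0 _ _ (by positivity) hR)
    (fun i => hent j _ (by positivity)) (J := J) ?_ hsum').trans
    (ENNReal.ofReal_le_ofReal ?_)
  · rw [div_le_iff₀ hR] at hJ1
    rw [div_le_div_iff₀ h2J (by norm_num)]
    have h1 := mul_le_mul_of_nonneg_left hJ1 hR.le
    have h2 : D₁ * R ≤ R := by nlinarith
    nlinarith
  · exact mul_le_mul_of_nonneg_right hJ3 (Real.exp_pos _).le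

lemma tendsto_log_div_sqrt : Tendsto (fun m : ℕ => Real.log m / √m) atTop (nhds 0) := by
  have h := (isLittleO_log_rpow_atTop (r := 1 / 2) (by norm_num)).tendsto_div_nhds_zero
  have h2 := h.comp tendsto_natCast_atTop_atTop
  refine h2.congr fun m => ?_
  simp [Real.sqrt_eq_rpow]

lemma tendsto_log_natCast : Tendsto (fun m : ℕ => Real.log m) atTop atTop :=
  Real.tendsto_log_atTop.comp tendsto_natCast_atTop_atTop

/-- For large samples the whole parameter space admits a finite bracketing. -/
theorem EntropyCondition.eventually_exists_isBracketing
    {E : ∀ m, Fin (k m) → Experiment.{u, v} Θ m} {θ₀ : Θ} {D₁ D₂ D₃ : ℝ}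
    (h : EntropyCondition E θ₀ D₁ D₂ D₃) :
    ∀ᶠ m : ℕ in atTop, ∀ j : Fin (k m), ∃ N l u, (E m j).IsBracketing 1 Set.univ N l u := by
  obtain ⟨Ψ, -, -, -, hev⟩ := h
  -- Radius 2 is eventually admissible, and its ball is everything because h² ≤ 2.
  have h1 : ∀ᶠ m : ℕ in atTop, D₃ * (Real.log m / √m) < 2 := by
    have := tendsto_log_div_sqrt.const_mul D₃
    rw [mul_zero] at this
    exact this.eventually_lt_const (by norm_num)
  filter_upwards [hev, h1, eventually_gt_atTop 0] with m hm hm2 hm0 j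
  obtain ⟨N, -, l, u, hlu⟩ :=
    (E m j).exists_isBracketing ((hm 2 (by norm_num) hm2.le).1 j 1 one_pos)
  have e : {θ | (E m j).pseudoHellinger θ θ₀ ≤ 2} = Set.univ := by
    refine Set.eq_univ_of_forall fun θ => ?_
    have := (E m j).pseudoHellinger_sq_le_two hm0 θ θ₀
    simp only [Set.mem_ofPred_eq]
    nlinarith
  rw [e] at hlu
  exact ⟨N, l, u, hlu⟩

/-- Uniform exponential smallness of the likelihood ratios away from `θ₀`. -/
theorem EntropyCondition.eventually_measure_far_le
    {E : ∀ m, Fin (k m) → Experiment.{u, v} Θ m} {θ₀ : Θ} {D₁ D₂ D₃ : ℝ}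
    (hD₁ : 0 < D₁) (hD₁' : D₁ ≤ 1) (hD₃ : 0 < D₃)
    (h : EntropyCondition E θ₀ D₁ D₂ D₃) {K : ℕ} (hK : 2 ≤ K) (hKD : 2 ^ 12 * D₂ ≤ K * D₁)
    {M : ℝ} (hM : 2 ^ 9 ≤ M) (hMK : K * D₃ ≤ M) :
    ∀ᶠ m : ℕ in atTop, ∀ j : Fin (k m),
      (E m j).jointLaw θ₀ {y | ∃ θ, M * (Real.log m / √m) ≤ (E m j).pseudoHellinger θ θ₀ ∧
        Real.exp (-(M ^ 2 * Real.log m ^ 2 / 2)) * ∏ i, (E m j).p i θ₀ (y i) <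
          ∏ i, (E m j).p i θ (y i)} ≤
      ENNReal.ofReal (Real.exp (-Real.log m ^ 2)) := by
  have h1 : ∀ᶠ m : ℕ in atTop, M * (Real.log m / √m) < 2 := by
    have := tendsto_log_div_sqrt.const_mul M
    rw [mul_zero] at this
    exact this.eventually_lt_const (by norm_num)
  filter_upwards [h.eventually_measure_shell_le hD₁ hD₁' hD₃ hK hKD, h1,
    eventually_gt_atTop 0, tendsto_log_natCast.eventually_ge_atTop 3] with m hm hr2 hm0 hlog j
  set r := M * (Real.log m / √m) with hr
  have hm0' : (0 : ℝ) < m := by exact_mod_cast hm0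
  have hM0 : 0 < M := by linarith
  have hr0 : 0 < r := by rw [hr]; positivity
  have hmr : m * r ^ 2 = M ^ 2 * Real.log m ^ 2 := by
    rw [hr, mul_pow, div_pow, Real.sq_sqrt hm0'.le]; field_simp
  have hKr : K * D₃ * (Real.log m / √m) ≤ r :=
    mul_le_mul_of_nonneg_right hMK (by positivity)
  set S := ⌈2 / r⌉₊ with hS
  -- Shells with outer radius above 4 are declared empty, as the shell estimate needs R ≤ 4. Those
  -- that meet h ≤ 2 have outer radius at most 4 and index s < 2^s ≤ 2/r.
  set B : ℕ → Set (∀ i, (E m j).Obs i) := fun s =>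
    {y | 2 ^ (s + 1) * r ≤ 4 ∧ ∃ θ, 2 ^ (s + 1) * r / 2 ≤ (E m j).pseudoHellinger θ θ₀ ∧
        (E m j).pseudoHellinger θ θ₀ ≤ 2 ^ (s + 1) * r ∧
        Real.exp (-(m * (2 ^ (s + 1) * r) ^ 2 / 8)) *
          ∏ i, (E m j).p i θ₀ (y i) < ∏ i, (E m j).p i θ (y i)} with hB
  have hRs : ∀ s : ℕ, 2 * r ≤ 2 ^ (s + 1) * r := fun s => by
    have : (1 : ℝ) ≤ 2 ^ s := one_le_pow₀ (by norm_num)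
    rw [pow_succ]; nlinarith
  have hBm : ∀ s, (E m j).jointLaw θ₀ (B s) ≤
      ENNReal.ofReal (2 ^ 10 / r * Real.exp (-(m * r ^ 2 / 2 ^ 16))) := by
    intro s
    by_cases hs4 : 2 ^ (s + 1) * r ≤ 4
    · have e1 := hRs s
      refine (measure_mono fun y hy => hy.2).trans ((hm j (2 ^ (s + 1) * r) (by positivity) hs4
        (by linarith)).trans (ENNReal.ofReal_le_ofReal ?_))
      have e2 : (2 * r) ^ 2 ≤ (2 ^ (s + 1) * r) ^ 2 := pow_le_pow_left₀ (by positivity) e1 2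
      refine mul_le_mul ?_ (Real.exp_le_exp.2 ?_) (Real.exp_pos _).le (by positivity)
      · rw [div_le_div_iff₀ (by positivity) hr0]; linarith
      · have := mul_le_mul_of_nonneg_left e2 hm0'.le
        linarith
    · have : B s = ∅ := by
        ext y; simp only [hB, Set.mem_ofPred_eq, Set.mem_empty_iff_false, iff_false]
        exact fun hy => hs4 hy.1
      rw [this]; simp
  have hsub : {y | ∃ θ, r ≤ (E m j).pseudoHellinger θ θ₀ ∧
        Real.exp (-(M ^ 2 * Real.log m ^ 2 / 2)) * ∏ i, (E m j).p i θ₀ (y i) <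
          ∏ i, (E m j).p i θ (y i)} ⊆ ⋃ s ∈ Finset.range S, B s := by
    rintro y ⟨θ, hθ, hy⟩
    set x := (E m j).pseudoHellinger θ θ₀ with hx
    obtain ⟨s, hs1, hs2⟩ := exists_nat_pow_near (x := x / r) (y := 2)
      (by rw [one_le_div hr0]; exact hθ) (by norm_num)
    rw [le_div_iff₀ hr0] at hs1
    rw [div_lt_iff₀ hr0] at hs2
    have hx2 : x ≤ 2 := by
      have := (E m j).pseudoHellinger_sq_le_two hm0 θ θ₀
      nlinarith
    have e1 : (2 : ℝ) ^ (s + 1) * r = 2 * (2 ^ s * r) := by ring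
    simp only [Set.mem_iUnion, Finset.mem_range]
    refine ⟨s, ?_, ?_, θ, by rw [e1]; linarith, hs2.le, ?_⟩
    · rw [hS, Nat.lt_ceil, lt_div_iff₀ hr0]
      have : (s : ℝ) < 2 ^ s := by exact_mod_cast Nat.lt_two_pow_self
      nlinarith
    · rw [e1]; linarith
    · refine lt_of_le_of_lt (mul_le_mul_of_nonneg_right (Real.exp_le_exp.2 ?_)
        (Finset.prod_nonneg fun i _ => (E m j).nonneg_p _ _ _)) hy
      have e2 : (2 * r) ^ 2 ≤ (2 ^ (s + 1) * r) ^ 2 :=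
        pow_le_pow_left₀ (by positivity) (hRs s) 2
      have := mul_le_mul_of_nonneg_left e2 hm0'.le
      linarith
  refine (measure_mono hsub).trans ((measure_biUnion_finset_le _ _).trans
    ((Finset.sum_le_sum fun s _ => hBm s).trans ?_))
  rw [Finset.sum_const, Finset.card_range, nsmul_eq_mul, ← ENNReal.ofReal_natCast,
    ← ENNReal.ofReal_mul (Nat.cast_nonneg S)]
  refine ENNReal.ofReal_le_ofReal ?_
  have hSr : (S : ℝ) ≤ 4 / r := by
    have e1 := (Nat.ceil_lt_add_one (show 0 ≤ 2 / r by positivity)).le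
    have e2 : 1 ≤ 2 / r := by rw [one_le_div hr0]; exact hr2.le
    calc (S : ℝ) ≤ 2 / r + 1 := e1
      _ ≤ 2 / r + 2 / r := by linarith
      _ = 4 / r := by ring
  have hmr1 : 1 ≤ m * r ^ 2 := by
    rw [hmr, ← mul_pow]
    exact one_le_pow₀ (by nlinarith)
  -- Number of shells times prefactor: mr² ≥ 1 reduces this to a multiple of m, hence to e^{3 log²
  -- m}. The decay e^{-4 log² m}, from M ≥ 2⁹, wins.
  have e3 : 4 / r * (2 ^ 10 / r) ≤ 2 ^ 12 * m := by
    rw [div_mul_div_comm, div_le_iff₀ (by positivity)]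
    nlinarith
  have e4 : (2 : ℝ) ^ 12 * m ≤ Real.exp (3 * Real.log m ^ 2) := by
    have f1 : (m : ℝ) ≤ Real.exp (Real.log m ^ 2) := by
      rw [← Real.exp_log hm0', Real.log_exp]
      exact Real.exp_le_exp.2 (by nlinarith)
    have f2 : (2 : ℝ) ^ 12 ≤ Real.exp (2 * Real.log m ^ 2) := by
      calc (2 : ℝ) ^ 12 ≤ Real.exp 1 ^ 12 := by
            have := Real.add_one_le_exp (1 : ℝ)
            gcongr; linarith
        _ = Real.exp 12 := by rw [← Real.exp_nat_mul]; norm_num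
        _ ≤ _ := Real.exp_le_exp.2 (by nlinarith)
    calc _ ≤ Real.exp (2 * Real.log m ^ 2) * Real.exp (Real.log m ^ 2) := by gcongr
      _ = _ := by rw [← Real.exp_add]; ring_nf
  have e5 : Real.exp (-(m * r ^ 2 / 2 ^ 16)) ≤ Real.exp (-(4 * Real.log m ^ 2)) := by
    refine Real.exp_le_exp.2 ?_
    rw [hmr]
    have : (2 ^ 9) ^ 2 * Real.log m ^ 2 ≤ M ^ 2 * Real.log m ^ 2 := by gcongr
    linarith
  calc (S : ℝ) * (2 ^ 10 / r * Real.exp (-(m * r ^ 2 / 2 ^ 16)))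
      ≤ 4 / r * (2 ^ 10 / r * Real.exp (-(m * r ^ 2 / 2 ^ 16))) := by gcongr
    _ = 4 / r * (2 ^ 10 / r) * Real.exp (-(m * r ^ 2 / 2 ^ 16)) := by ring
    _ ≤ Real.exp (3 * Real.log m ^ 2) * Real.exp (-(4 * Real.log m ^ 2)) :=
        mul_le_mul (e3.trans e4) e5 (Real.exp_pos _).le (Real.exp_pos _).le
    _ = _ := by rw [← Real.exp_add]; ring_nf

end Shells

/-! ### Lower bound for the normalizing constant. -/

section Evidence

set_option linter.unusedSectionVars false

variable {Θ : Type u} [MeasurableSpace Θ] {m : ℕ} (E : Experiment.{u, v} Θ m)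

/-- `exp (κ log₊ (p_i(y | θ₀) / p_i(y | θ)))`, as a power. -/
noncomputable def Experiment.ratioPower (κ : ℝ) (θ₀ θ : Θ) (i : Fin m) (y : E.Obs i) : ℝ≥0∞ :=
  (max (ENNReal.ofReal (E.p i θ₀ y) / ENNReal.ofReal (E.p i θ y)) 1) ^ κ

lemma exp_mul_logPlus (κ : ℝ) (x : ℝ≥0∞) :
    EReal.exp ((κ : EReal) * logPlus x) = (max x 1) ^ κ := by
  have : logPlus x = ENNReal.log (max x 1) := by
    rw [ENNReal.log_monotone.map_max, ENNReal.log_one, logPlus]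
  rw [this, ENNReal.rpow_eq_exp_mul_log]

lemma Experiment.expLogPlusMean_eq (κ : ℝ) (θ₀ θ : Θ) :
    E.expLogPlusMean κ θ₀ θ =
      (m : ℝ≥0∞)⁻¹ * ∑ i, ∫⁻ y, E.ratioPower κ θ₀ θ i y ∂(E.law θ₀ i) := by
  simp only [Experiment.expLogPlusMean, exp_mul_logPlus, Experiment.ratioPower]

lemma Experiment.measurable_ratioPower (κ : ℝ) (θ₀ : Θ) (i : Fin m) :
    Measurable fun z : Θ × E.Obs i => E.ratioPower κ θ₀ z.1 i z.2 := by
  have h1 := E.measurable_p i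
  have h2 : Measurable fun z : Θ × E.Obs i => E.p i θ₀ z.2 :=
    (E.measurable_density i θ₀).comp measurable_snd
  exact ((h2.ennreal_ofReal.div h1.ennreal_ofReal).max measurable_const).pow_const κ

lemma Experiment.one_le_ratioPower {κ : ℝ} (hκ : 0 ≤ κ) (θ₀ θ : Θ) (i : Fin m) (y : E.Obs i) :
    1 ≤ E.ratioPower κ θ₀ θ i y := by
  calc (1 : ℝ≥0∞) = 1 ^ κ := (ENNReal.one_rpow κ).symm
    _ ≤ _ := ENNReal.rpow_le_rpow (le_max_right _ _) hκ

lemma Experiment.measurable_expLogPlusMean (κ : ℝ) (θ₀ : Θ) :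
    Measurable (E.expLogPlusMean κ θ₀) := by
  have : E.expLogPlusMean κ θ₀ = fun θ =>
      (m : ℝ≥0∞)⁻¹ * ∑ i, ∫⁻ y, E.ratioPower κ θ₀ θ i y ∂(E.law θ₀ i) :=
    funext (E.expLogPlusMean_eq κ θ₀)
  rw [this]
  exact (Finset.measurable_sum _ fun i _ =>
    (E.measurable_ratioPower κ θ₀ i).lintegral_prod_right').const_mul _

/-- The product over the observations of `ratioPower`. -/
noncomputable def Experiment.ratioPowerProd (κ : ℝ) (θ₀ θ : Θ) (y : ∀ i, E.Obs i) : ℝ≥0∞ :=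
  ∏ i, E.ratioPower κ θ₀ θ i (y i)

lemma Experiment.measurable_ratioPowerProd (κ : ℝ) (θ₀ : Θ) :
    Measurable fun z : Θ × (∀ i, E.Obs i) => E.ratioPowerProd κ θ₀ z.1 z.2 := by
  refine Finset.measurable_prod _ fun i _ => ?_
  exact (E.measurable_ratioPower κ θ₀ i).comp
    (measurable_fst.prodMk ((measurable_pi_apply i).comp measurable_snd))

lemma Experiment.measurable_ratioPowerProd_swap (κ : ℝ) (θ₀ : Θ) :
    Measurable (Function.uncurry fun (y : ∀ i, E.Obs i) θ => E.ratioPowerProd κ θ₀ θ y) := by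
  unfold Function.uncurry Experiment.ratioPowerProd
  refine Finset.measurable_prod _ fun i _ => ?_
  exact (E.measurable_ratioPower κ θ₀ i).comp
    (measurable_snd.prodMk ((measurable_pi_apply i).comp measurable_fst))

lemma Experiment.measurable_ratioPowerProd_left (κ : ℝ) (θ₀ : Θ) (y : ∀ i, E.Obs i) :
    Measurable fun θ => E.ratioPowerProd κ θ₀ θ y := by
  refine Finset.measurable_prod _ fun i _ => ?_
  exact (E.measurable_ratioPower κ θ₀ i).comp measurable_prodMk_right

/-- By independence the mean is the product of the b_i, and b ≤ e^{b-1} turns the bound on their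
average into a bound on the product. -/
lemma Experiment.lintegral_ratioPowerProd_le (hm : 0 < m) {κ L : ℝ} (hL : 0 ≤ L) {θ₀ θ : Θ}
    (h : E.expLogPlusMean κ θ₀ θ ≤ 1 + ENNReal.ofReal (L / m)) :
    ∫⁻ y, E.ratioPowerProd κ θ₀ θ y ∂(E.jointLaw θ₀) ≤ ENNReal.ofReal (Real.exp L) := by
  have hm0 : (0 : ℝ) < m := by exact_mod_cast hm
  simp only [Experiment.ratioPowerProd, Experiment.jointLaw]
  rw [lintegral_pi_prod (E.law θ₀) (fun i => E.ratioPower κ θ₀ θ i) fun i =>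
    (E.measurable_ratioPower κ θ₀ i).comp measurable_prodMk_left]
  set b : Fin m → ℝ≥0∞ := fun i => ∫⁻ y, E.ratioPower κ θ₀ θ i y ∂(E.law θ₀ i) with hb
  rw [E.expLogPlusMean_eq, ENNReal.inv_mul_le_iff (by exact_mod_cast hm.ne')
    (ENNReal.natCast_ne_top m)] at h
  have hsum : ∑ i, b i ≤ ENNReal.ofReal (m + L) := by
    refine h.trans (le_of_eq ?_)
    rw [← ENNReal.ofReal_one, ← ENNReal.ofReal_add zero_le_one (by positivity),
      ← ENNReal.ofReal_natCast, ← ENNReal.ofReal_mul hm0.le]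
    congr 1
    field_simp
  have htop : ∀ i, b i ≠ ⊤ := fun i =>
    (((Finset.single_le_sum (fun _ _ => zero_le) (Finset.mem_univ i)).trans hsum).trans_lt
      ENNReal.ofReal_lt_top).ne
  have hreal : ∑ i, (b i).toReal ≤ m + L := by
    rw [← ENNReal.toReal_sum fun i _ => htop i]
    exact ENNReal.toReal_le_of_le_ofReal (by positivity) hsum
  calc ∏ i, b i ≤ ∏ i, ENNReal.ofReal (Real.exp ((b i).toReal - 1)) := by
        refine Finset.prod_le_prod' fun i _ => ?_
        rw [← ENNReal.ofReal_toReal (htop i)]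
        refine ENNReal.ofReal_le_ofReal ?_
        rw [ENNReal.toReal_ofReal ENNReal.toReal_nonneg]
        linarith [Real.add_one_le_exp ((b i).toReal - 1)]
    _ = ENNReal.ofReal (Real.exp (∑ i, ((b i).toReal - 1))) := by
        rw [Real.exp_sum, ENNReal.ofReal_prod_of_nonneg fun i _ => (Real.exp_pos _).le]
    _ ≤ _ := by
        refine ENNReal.ofReal_le_ofReal (Real.exp_le_exp.2 ?_)
        rw [Finset.sum_sub_distrib]
        simp
        linarith

/-- All factors are at least 1, so the product dominates each of them, and a factor is infinite
where p_θ vanishes. -/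
lemma Experiment.density_pos_of_ratioPowerProd_lt_top {κ : ℝ} (hκ : 0 < κ) {θ₀ θ : Θ}
    {y : ∀ i, E.Obs i} (hy : ∀ i, 0 < E.p i θ₀ (y i)) (h : E.ratioPowerProd κ θ₀ θ y < ⊤)
    (i : Fin m) : 0 < E.p i θ (y i) := by
  refine (E.nonneg_p i θ (y i)).lt_of_ne fun h0 => ?_
  have h1 : E.ratioPower κ θ₀ θ i (y i) ≤ E.ratioPowerProd κ θ₀ θ y :=
    Finset.single_le_prod' (f := fun i => E.ratioPower κ θ₀ θ i (y i))
      (fun i _ => E.one_le_ratioPower hκ.le θ₀ θ i _) (Finset.mem_univ i)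
  have h2 : E.ratioPower κ θ₀ θ i (y i) = ⊤ := by
    rw [Experiment.ratioPower, ← h0, ENNReal.ofReal_zero,
      ENNReal.div_zero (by simpa using hy i)]
    simp [hκ]
  rw [h2] at h1
  exact absurd (h1.trans_lt h) (lt_irrefl _)

lemma Experiment.le_prod_density_of_ratioPowerProd_le {κ c : ℝ} (hκ : 0 < κ) {θ₀ θ : Θ}
    {y : ∀ i, E.Obs i} (hy : ∀ i, 0 < E.p i θ₀ (y i))
    (h : E.ratioPowerProd κ θ₀ θ y ≤ ENNReal.ofReal (Real.exp (c * κ))) :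
    Real.exp (-c) * ∏ i, E.p i θ₀ (y i) ≤ ∏ i, E.p i θ (y i) := by
  have hp := E.density_pos_of_ratioPowerProd_lt_top hκ hy (h.trans_lt ENNReal.ofReal_lt_top)
  have hP : 0 < ∏ i, E.p i θ (y i) := Finset.prod_pos fun i _ => hp i
  have hP0 : 0 < ∏ i, E.p i θ₀ (y i) := Finset.prod_pos fun i _ => hy i
  have h1 : ENNReal.ofReal ((∏ i, E.p i θ₀ (y i) / E.p i θ (y i)) ^ κ) ≤
      E.ratioPowerProd κ θ₀ θ y := by
    rw [← Real.finsetProd_rpow _ _ fun i _ => (div_pos (hy i) (hp i)).le,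
      ENNReal.ofReal_prod_of_nonneg fun i _ => by have := hy i; have := hp i; positivity]
    refine Finset.prod_le_prod' fun i _ => ?_
    rw [Experiment.ratioPower, ← ENNReal.ofReal_div_of_pos (hp i),
      ← ENNReal.ofReal_rpow_of_nonneg (div_pos (hy i) (hp i)).le hκ.le]
    exact ENNReal.rpow_le_rpow (le_max_left _ _) hκ.le
  have h2 := (ENNReal.ofReal_le_ofReal_iff (Real.exp_pos _).le).1 (h1.trans h)
  rw [Real.exp_mul, Real.rpow_le_rpow_iff (Finset.prod_nonneg fun i _ =>
    (div_pos (hy i) (hp i)).le) (Real.exp_pos _).le hκ, Finset.prod_div_distrib,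
    div_le_iff₀ hP] at h2
  rw [Real.exp_neg, inv_mul_le_iff₀ (Real.exp_pos _)]
  exact h2

lemma Experiment.measurable_temperedLikelihood (γ : ℝ) (y : ∀ i, E.Obs i) :
    Measurable (E.temperedLikelihood γ y) := by
  unfold Experiment.temperedLikelihood
  refine ((Finset.measurable_prod _ fun i _ => ?_).pow_const γ).ennreal_ofReal
  exact (E.measurable_p i).comp measurable_prodMk_right

variable (prior : Measure Θ) [IsProbabilityMeasure prior]

/-- The integral of `ratioPowerProd` over a set of parameters. -/
noncomputable def Experiment.ratioIntegral (κ : ℝ) (θ₀ : Θ) (A : Set Θ) (y : ∀ i, E.Obs i) :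
    ℝ≥0∞ :=
  ∫⁻ θ in A, E.ratioPowerProd κ θ₀ θ y ∂prior

lemma Experiment.measurable_ratioIntegral (κ : ℝ) (θ₀ : Θ) (A : Set Θ) :
    Measurable (E.ratioIntegral prior κ θ₀ A) :=
  (E.measurable_ratioPowerProd κ θ₀).lintegral_prod_left'

lemma Experiment.lintegral_ratioIntegral_le (hm : 0 < m) {κ L : ℝ} (hL : 0 ≤ L) (θ₀ : Θ)
    {A : Set Θ} (hA : A = {θ | E.expLogPlusMean κ θ₀ θ ≤ 1 + ENNReal.ofReal (L / m)}) :
    ∫⁻ y, E.ratioIntegral prior κ θ₀ A y ∂(E.jointLaw θ₀) ≤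
      prior A * ENNReal.ofReal (Real.exp L) := by
  have hAm : MeasurableSet A := by
    rw [hA]; exact measurableSet_le (E.measurable_expLogPlusMean κ θ₀) measurable_const
  unfold Experiment.ratioIntegral
  rw [lintegral_lintegral_swap (E.measurable_ratioPowerProd_swap κ θ₀).aemeasurable]
  calc _ ≤ ∫⁻ _θ in A, ENNReal.ofReal (Real.exp L) ∂prior := by
        refine setLIntegral_mono' hAm fun θ hθ => ?_
        rw [hA] at hθ
        exact E.lintegral_ratioPowerProd_le hm hL hθ
    _ = _ := by rw [setLIntegral_const, mul_comm]

lemma Experiment.evidence_pos {κ γ : ℝ} (hκ : 0 < κ) {θ₀ : Θ} {A : Set Θ} (hA : prior A ≠ 0)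
    {y : ∀ i, E.Obs i} (hy : ∀ i, 0 < E.p i θ₀ (y i))
    (h : E.ratioIntegral prior κ θ₀ A y < ⊤) :
    ∫⁻ θ, E.temperedLikelihood γ y θ ∂prior ≠ 0 := by
  intro h0
  rw [lintegral_eq_zero_iff (E.measurable_temperedLikelihood γ y)] at h0
  have hm := E.measurable_ratioPowerProd_left κ θ₀ y
  have h1 := ae_lt_top hm h.ne
  have h2 := ae_restrict_of_ae (s := A) h0
  have h3 : ∀ᵐ _θ ∂(prior.restrict A), False := by
    filter_upwards [h1, h2] with θ hθ1 hθ2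
    have hp := E.density_pos_of_ratioPowerProd_lt_top hκ hy hθ1
    have : 0 < (∏ i, E.p i θ (y i)) ^ γ := Real.rpow_pos_of_pos (Finset.prod_pos fun i _ => hp i) γ
    simp only [Experiment.temperedLikelihood, Pi.zero_apply, ENNReal.ofReal_eq_zero] at hθ2
    linarith
  rw [eventually_false_iff_eq_bot, ae_eq_bot, Measure.restrict_eq_zero] at h3
  exact hA h3

lemma Experiment.evidence_lower_bound {κ γ L : ℝ} (hκ : 0 < κ) (hγ : 0 < γ) (hL : 1 ≤ L)
    {θ₀ : Θ} {A : Set Θ} (hAm : MeasurableSet A) {y : ∀ i, E.Obs i}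
    (hy : ∀ i, 0 < E.p i θ₀ (y i))
    (h : E.ratioIntegral prior κ θ₀ A y ≤ prior A * ENNReal.ofReal (Real.exp (2 * L))) :
    prior A / 2 * ENNReal.ofReal ((Real.exp (-(3 * L / κ)) * ∏ i, E.p i θ₀ (y i)) ^ γ) ≤
      ∫⁻ θ, E.temperedLikelihood γ y θ ∂prior := by
  have hm := E.measurable_ratioPowerProd_left κ θ₀ y
  -- Markov's inequality in θ: within A, B has prior mass at most e^{-L} Π(A), at most half of Π(A)
  -- because L ≥ 1.
  set B : Set Θ := {θ | ENNReal.ofReal (Real.exp (3 * L)) ≤ E.ratioPowerProd κ θ₀ θ y} with hB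
  have hBm : MeasurableSet B := measurableSet_le measurable_const hm
  have h1 : prior (B ∩ A) ≤ prior A / 2 := by
    rw [← Measure.restrict_apply hBm]
    have e0 : ENNReal.ofReal (Real.exp (3 * L)) ≠ 0 := by simp [Real.exp_pos]
    refine (meas_ge_le_lintegral_div hm.aemeasurable e0 ENNReal.ofReal_ne_top).trans ?_
    refine ENNReal.div_le_of_le_mul (h.trans ?_)
    rw [ENNReal.div_eq_inv_mul, mul_comm (2 : ℝ≥0∞)⁻¹, mul_assoc]
    refine mul_le_mul_right ?_ _
    rw [← ENNReal.div_eq_inv_mul]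
    rw [ENNReal.le_div_iff_mul_le (Or.inl (by norm_num)) (Or.inl (by norm_num)),
      ← ENNReal.ofReal_ofNat, ← ENNReal.ofReal_mul (Real.exp_pos _).le]
    refine ENNReal.ofReal_le_ofReal ?_
    have e1 : (2 : ℝ) ≤ Real.exp L := by linarith [Real.add_one_le_exp L]
    calc Real.exp (2 * L) * 2 ≤ Real.exp (2 * L) * Real.exp L := by gcongr
      _ = _ := by rw [← Real.exp_add]; ring_nf
  have h2 : prior A / 2 ≤ prior (A \ B) := by
    have e1 : prior A ≤ prior (B ∩ A) + prior (A \ B) := by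
      rw [Set.inter_comm]; exact measure_le_inter_add_sdiff _ _ _
    have e2 : prior A ≤ prior A / 2 + prior (A \ B) := e1.trans (add_le_add_left h1 _)
    by_contra hlt
    rw [not_le] at hlt
    have e3 : prior A / 2 + prior (A \ B) < prior A / 2 + prior A / 2 :=
      ENNReal.add_lt_add_left (ENNReal.div_ne_top (measure_ne_top _ _) (by norm_num)) hlt
    rw [ENNReal.add_halves] at e3
    exact absurd (e2.trans_lt e3) (lt_irrefl _)
  calc _ ≤ prior (A \ B) *
        ENNReal.ofReal ((Real.exp (-(3 * L / κ)) * ∏ i, E.p i θ₀ (y i)) ^ γ) :=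
        mul_le_mul_left h2 _
    _ = ∫⁻ _θ in A \ B,
        ENNReal.ofReal ((Real.exp (-(3 * L / κ)) * ∏ i, E.p i θ₀ (y i)) ^ γ) ∂prior := by
        rw [setLIntegral_const, mul_comm]
    _ ≤ ∫⁻ θ in A \ B, E.temperedLikelihood γ y θ ∂prior := by
        refine setLIntegral_mono' (hAm.diff hBm) fun θ hθ => ?_
        have hθB : E.ratioPowerProd κ θ₀ θ y < ENNReal.ofReal (Real.exp (3 * L)) :=
          not_le.1 hθ.2
        refine ENNReal.ofReal_le_ofReal (Real.rpow_le_rpow (mul_nonneg (Real.exp_pos _).le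
          (Finset.prod_nonneg fun i _ => E.nonneg_p _ _ _)) ?_ hγ.le)
        refine E.le_prod_density_of_ratioPowerProd_le hκ hy (hθB.le.trans (le_of_eq ?_))
        rw [div_mul_cancel₀ _ hκ.ne']
    _ ≤ _ := setLIntegral_le_lintegral _ _

/-- A finite bracketing of the whole parameter space makes the normalizing constant finite. -/
lemma Experiment.evidence_ne_top {δ : ℝ} {N : ℕ} {l u : Fin N → ∀ i, E.Obs i → ℝ}
    (h : E.IsBracketing δ Set.univ N l u) {γ : ℝ} (hγ : 0 < γ) (y : ∀ i, E.Obs i) :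
    ∫⁻ θ, E.temperedLikelihood γ y θ ∂prior ≠ ⊤ := by
  have h1 : ∀ θ, E.temperedLikelihood γ y θ ≤
      ∑ s, ENNReal.ofReal ((∏ i, u s i (y i)) ^ γ) := by
    intro θ
    obtain ⟨s, hs, -⟩ := h.2 θ (Set.mem_univ θ)
    refine le_trans (ENNReal.ofReal_le_ofReal (Real.rpow_le_rpow
      (Finset.prod_nonneg fun i _ => E.nonneg_p _ _ _) (Finset.prod_le_prod
      (fun i _ => E.nonneg_p _ _ _) fun i _ => (hs i (y i)).2) hγ.le))
      (Finset.single_le_sum (f := fun s => ENNReal.ofReal ((∏ i, u s i (y i)) ^ γ))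
        (fun _ _ => zero_le) (Finset.mem_univ s))
  refine ((lintegral_mono h1).trans_lt ?_).ne
  rw [lintegral_const, measure_univ, mul_one]
  exact ENNReal.sum_lt_top.2 fun s _ => ENNReal.ofReal_lt_top

lemma Experiment.isProbabilityMeasure_posterior {γ : ℝ} {y : ∀ i, E.Obs i}
    (h0 : ∫⁻ θ, E.temperedLikelihood γ y θ ∂prior ≠ 0)
    (h1 : ∫⁻ θ, E.temperedLikelihood γ y θ ∂prior ≠ ⊤) :
    IsProbabilityMeasure (E.posterior prior γ y) := by
  constructor
  rw [Experiment.posterior, Measure.smul_apply, withDensity_apply _ MeasurableSet.univ,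
    Measure.restrict_univ, smul_eq_mul, ENNReal.inv_mul_cancel h0 h1]

lemma Experiment.lintegral_posterior {γ : ℝ} {y : ∀ i, E.Obs i} {f : Θ → ℝ≥0∞}
    (hf : Measurable f) :
    ∫⁻ θ, f θ ∂(E.posterior prior γ y) =
      (∫⁻ θ, E.temperedLikelihood γ y θ ∂prior)⁻¹ *
        ∫⁻ θ, E.temperedLikelihood γ y θ * f θ ∂prior := by
  rw [Experiment.posterior, lintegral_smul_measure,
    lintegral_withDensity_eq_lintegral_mul _ (E.measurable_temperedLikelihood γ y) hf]
  rfl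

end Evidence

/-! ### Wasserstein bound and assembly. -/

/-- The Wasserstein distance to a point mass, bounded through the product coupling. -/
lemma W₂_dirac_sq_le {X : Type u} [PseudoEMetricSpace X] [MeasurableSpace X]
    [OpensMeasurableSpace X] [SecondCountableTopology X] (μ : Measure X)
    [IsProbabilityMeasure μ] (x : X) :
    W₂ μ (Measure.dirac x) ^ 2 ≤ ∫⁻ z, edist z x ^ 2 ∂μ := by
  have h1 : W₂ μ (Measure.dirac x) ^ 2 = ⨅ (π : Measure (X × X)) (_ : IsProbabilityMeasure π ∧
      π.map Prod.fst = μ ∧ π.map Prod.snd = Measure.dirac x), ∫⁻ z, edist z.1 z.2 ^ 2 ∂π := by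
    rw [W₂, ← ENNReal.rpow_natCast, ← ENNReal.rpow_mul]
    norm_num
  rw [h1]
  refine iInf₂_le_of_le (μ.prod (Measure.dirac x)) ⟨inferInstance, ?_, ?_⟩ ?_
  · rw [Measure.map_fst_prod, measure_univ, one_smul]
  · rw [Measure.map_snd_prod, measure_univ, one_smul]
  · rw [lintegral_prod _ (by fun_prop)]
    refine le_of_eq (lintegral_congr fun z => ?_)
    exact lintegral_dirac' x (by fun_prop)

lemma sq_le_rpow_of_rpow_le {α x d : ℝ} (hα : 0 < α) (hd : 0 ≤ d) (h : d ^ (2 * α) ≤ x) :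
    d ^ 2 ≤ x ^ (1 / α) := by
  calc d ^ 2 = (d ^ (2 * α)) ^ (1 / α) := by
        rw [← Real.rpow_mul hd, ← Real.rpow_natCast]
        congr 1
        field_simp
        norm_num
    _ ≤ _ := Real.rpow_le_rpow (Real.rpow_nonneg hd _) h (by positivity)

/-- log² x ≥ (log x)/α gives the bound x^{-1/α}, which log² x ≥ 1 only enlarges: exceptional
probabilities are below the target rate. -/
lemma exp_neg_log_sq_le {α x : ℝ} (hα : 0 < α) (h0 : 0 < x) (h1 : 1 ≤ Real.log x)
    (h2 : 1 / α ≤ Real.log x) :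
    Real.exp (-Real.log x ^ 2) ≤ (Real.log x ^ 2 / x) ^ (1 / α) := by
  calc Real.exp (-Real.log x ^ 2) ≤ Real.exp (-Real.log x * (1 / α)) :=
        Real.exp_le_exp.2 (by nlinarith)
    _ = x⁻¹ ^ (1 / α) := by
        rw [Real.rpow_def_of_pos (inv_pos.2 h0), Real.log_inv]
    _ ≤ _ := by
        refine Real.rpow_le_rpow (inv_pos.2 h0).le ?_ (by positivity)
        rw [inv_eq_one_div]
        exact div_le_div_of_nonneg_right (one_le_pow₀ h1) h0.le

variable {m : ℕ}

/-- In either case likelihood times ρ² is at most likelihood · e + D · β, so the near and far sets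
need not be measurable. -/
lemma Experiment.W₂_posterior_sq_le {Θ : Type u} [MetricSpace Θ] [CompactSpace Θ]
    [MeasurableSpace Θ] [BorelSpace Θ] (E : Experiment.{u, v} Θ m) (prior : Measure Θ)
    [IsProbabilityMeasure prior] (θ₀ : Θ) {γ : ℝ} {y : ∀ i, E.Obs i}
    (h0 : ∫⁻ θ, E.temperedLikelihood γ y θ ∂prior ≠ 0)
    (h1 : ∫⁻ θ, E.temperedLikelihood γ y θ ∂prior ≠ ⊤) {e D β : ℝ≥0∞}
    (hD : ∀ θ, edist θ θ₀ ^ 2 ≤ D)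
    (h : ∀ θ, edist θ θ₀ ^ 2 ≤ e ∨ E.temperedLikelihood γ y θ ≤ β) :
    W₂ (E.posterior prior γ y) (Measure.dirac θ₀) ^ 2 ≤
      e + (∫⁻ θ, E.temperedLikelihood γ y θ ∂prior)⁻¹ * (D * β) := by
  have : SecondCountableTopology Θ := EMetric.secondCountable_of_sigmaCompact Θ
  have := E.isProbabilityMeasure_posterior prior h0 h1
  refine (W₂_dirac_sq_le _ θ₀).trans ?_
  rw [E.lintegral_posterior prior (by fun_prop)]
  set Z := ∫⁻ θ, E.temperedLikelihood γ y θ ∂prior with hZ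
  have hle : ∫⁻ θ, E.temperedLikelihood γ y θ * edist θ θ₀ ^ 2 ∂prior ≤ Z * e + D * β := by
    calc _ ≤ ∫⁻ θ, (E.temperedLikelihood γ y θ * e + D * β) ∂prior := by
          refine lintegral_mono fun θ => ?_
          rcases h θ with hθ | hθ
          · exact (mul_le_mul_right hθ _).trans le_self_add
          · rw [mul_comm D β]
            exact (mul_le_mul' hθ (hD θ)).trans le_add_self
      _ = Z * e + D * β := by
          rw [lintegral_add_right _ measurable_const,
            lintegral_mul_const _ (E.measurable_temperedLikelihood γ y), lintegral_const,
            measure_univ, mul_one]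
  calc _ ≤ Z⁻¹ * (Z * e + D * β) := mul_le_mul_right hle _
    _ = e + Z⁻¹ * (D * β) := by rw [mul_add, ← mul_assoc, ENNReal.inv_mul_cancel h0 h1, one_mul]

/-- The posterior mass away from `θ₀`, once the likelihood there and the evidence are controlled. -/
lemma inv_evidence_mul_le {Z a : ℝ≥0∞} {D P₀ γ L b c q k : ℝ} (hD : 0 ≤ D) (hP₀ : 0 ≤ P₀)
    (hZ0 : Z ≠ 0) (hZt : Z ≠ ⊤) (ha : ENNReal.ofReal (Real.exp (-q * k * L)) ≤ a)
    (hZ : a / 2 * ENNReal.ofReal ((Real.exp (-c) * P₀) ^ γ) ≤ Z)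
    (hb : q * k * L + c * γ + L ≤ b * γ) :
    Z⁻¹ * (ENNReal.ofReal D * ENNReal.ofReal ((Real.exp (-b) * P₀) ^ γ)) ≤
      ENNReal.ofReal (2 * D * Real.exp (-L)) := by
  rw [ENNReal.inv_mul_le_iff hZ0 hZt]
  have h1 : ENNReal.ofReal (Real.exp (-q * k * L) / 2 * (Real.exp (-c) * P₀) ^ γ) ≤ Z := by
    refine le_trans ?_ hZ
    rw [ENNReal.ofReal_mul (by positivity), ENNReal.ofReal_div_of_pos (by norm_num),
      ENNReal.ofReal_ofNat]
    exact mul_le_mul_left (ENNReal.div_le_div_right ha 2) _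
  refine le_trans ?_ (mul_le_mul_left h1 _)
  rw [← ENNReal.ofReal_mul hD, ← ENNReal.ofReal_mul (by positivity)]
  refine ENNReal.ofReal_le_ofReal ?_
  rw [Real.mul_rpow (Real.exp_pos _).le hP₀, Real.mul_rpow (Real.exp_pos _).le hP₀,
    ← Real.exp_mul, ← Real.exp_mul]
  have h2 : Real.exp (-b * γ) ≤ Real.exp (-q * k * L) * Real.exp (-c * γ) * Real.exp (-L) := by
    rw [← Real.exp_add, ← Real.exp_add]
    exact Real.exp_le_exp.2 (by linarith)
  calc D * (Real.exp (-b * γ) * P₀ ^ γ)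
      ≤ D * (Real.exp (-q * k * L) * Real.exp (-c * γ) * Real.exp (-L) * P₀ ^ γ) := by gcongr
    _ = _ := by ring

lemma Experiment.measure_ratioIntegral_ge_le {Θ : Type u} [MeasurableSpace Θ]
    (E : Experiment.{u, v} Θ m) (prior : Measure Θ) [IsProbabilityMeasure prior] (hm : 0 < m)
    {κ L : ℝ} (hL : 0 ≤ L) (θ₀ : Θ) {A : Set Θ}
    (hA : A = {θ | E.expLogPlusMean κ θ₀ θ ≤ 1 + ENNReal.ofReal (L / m)}) (hA0 : prior A ≠ 0) :
    E.jointLaw θ₀ {y | prior A * ENNReal.ofReal (Real.exp (2 * L)) ≤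
      E.ratioIntegral prior κ θ₀ A y} ≤ ENNReal.ofReal (Real.exp (-L)) := by
  have h0 : prior A * ENNReal.ofReal (Real.exp (2 * L)) ≠ 0 :=
    mul_ne_zero hA0 (by simp [Real.exp_pos])
  refine (meas_ge_le_lintegral_div (E.measurable_ratioIntegral prior κ θ₀ A).aemeasurable h0
    (ENNReal.mul_ne_top (measure_ne_top _ _) ENNReal.ofReal_ne_top)).trans ?_
  refine ENNReal.div_le_of_le_mul ((E.lintegral_ratioIntegral_le prior hm hL θ₀ hA).trans
    (le_of_eq ?_))
  rw [mul_left_comm, ← ENNReal.ofReal_mul (Real.exp_pos _).le, ← Real.exp_add]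
  congr 3
  ring

end TemperedPosterior

open TemperedPosterior

theorem theorem3p1 (α C_L g₁ g₂ D₁ D₂ D₃ κ c_π : ℝ) (hα : 0 < α) (hC_L : 0 < C_L)
    (hg₁ : 0 < g₁) (hg₂ : 0 < g₂) (hD₁ : 0 < D₁) (hD₁' : D₁ ≤ 1) (hD₂ : 0 < D₂)
    (hD₂' : D₂ < D₁ ^ 2 / 2 ^ 12) (hD₃ : 0 < D₃) (hκ : 0 < κ) (hc_π : 0 < c_π) :
    ∃ C₁ : ℝ, 0 < C₁ ∧
      ∀ (Θ : Type u) [MetricSpace Θ] [CompactSpace Θ] [MeasurableSpace Θ] [BorelSpace Θ]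
        (prior : Measure Θ) [IsProbabilityMeasure prior] (θ₀ : Θ) (k : ℕ → ℕ) (γ : ℕ → ℝ)
        (E : ∀ m, Fin (k m) → TemperedPosterior.Experiment.{u, v} Θ m),
        TemperedPosterior.PowerCondition k γ g₁ g₂ →
        TemperedPosterior.SeparationCondition E α C_L →
        TemperedPosterior.EntropyCondition E θ₀ D₁ D₂ D₃ →
        TemperedPosterior.PriorThickness E prior θ₀ κ c_π →
        ∀ᶠ m : ℕ in atTop, ∀ j : Fin (k m),
          ∫⁻ y, TemperedPosterior.W₂ ((E m j).posterior prior (γ m) y) (Measure.dirac θ₀) ^ 2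
              ∂((E m j).jointLaw θ₀)
            ≤ ENNReal.ofReal (C₁ * (Real.log m ^ 2 / m) ^ (1 / α)) := by
  obtain ⟨K, hK⟩ := exists_nat_ge (max 2 (2 ^ 12 * D₂ / D₁))
  have hK2 : 2 ≤ K := by exact_mod_cast (le_max_left _ _).trans hK
  have hKD : 2 ^ 12 * D₂ ≤ K * D₁ := by
    rw [← div_le_iff₀ hD₁]; exact (le_max_right _ _).trans hK
  -- The summands of M serve the shell summation, the admissible radius, and the final exponent:
  -- evidence loss 3/κ, prior mass c_π g₂, and g₂ for a spare e^{-L}.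
  obtain ⟨M, hM⟩ : ∃ M : ℝ, M = 2 ^ 9 + K * D₃ + 2 * (3 / κ + c_π * g₂ + g₂) := ⟨_, rfl⟩
  have hκ3 : 0 < 3 / κ := by positivity
  have hcg : 0 < c_π * g₂ := by positivity
  have hKD3 : 0 ≤ K * D₃ := by positivity
  have hM9 : 2 ^ 9 ≤ M := by rw [hM]; linarith
  have hMK : K * D₃ ≤ M := by rw [hM]; linarith
  have hM2 : 3 / κ + c_π * g₂ + g₂ ≤ M ^ 2 / 2 := by
    have : 2 * (3 / κ + c_π * g₂ + g₂) ≤ M := by rw [hM]; linarith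
    nlinarith
  have hM0 : 0 < M := by linarith
  set D : ℝ := (2 / C_L) ^ (1 / α) with hD
  have hD0 : 0 < D := by positivity
  refine ⟨(M ^ 2 / C_L) ^ (1 / α) + 4 * D, by positivity, ?_⟩
  intro Θ _ _ _ _ prior _ θ₀ k γ E hpow hsep hent hthick
  filter_upwards [hpow, hsep, hent.eventually_measure_far_le hD₁ hD₁' hD₃ hK2 hKD hM9 hMK,
    hent.eventually_exists_isBracketing, hthick, eventually_gt_atTop 0,
    tendsto_log_natCast.eventually_ge_atTop 1, tendsto_log_natCast.eventually_ge_atTop (1 / α)]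
    with m hpow hsep hfar hbr hthick hm hlog1 hlogα j
  have hm0 : (0 : ℝ) < m := by exact_mod_cast hm
  obtain ⟨hγ, -, hkγ⟩ := hpow
  -- The existence of a subset j forces k ≥ 1, hence g₂ γ ≥ 1.
  have hk1 : (1 : ℝ) ≤ k m := by exact_mod_cast (Nat.succ_le_of_lt j.pos)
  have hkg : (k m : ℝ) ≤ g₂ * γ m := by
    push_cast at hkγ
    exact le_of_mul_le_mul_right hkγ hm0
  set L : ℝ := Real.log m ^ 2 with hL
  have hL1 : 1 ≤ L := one_le_pow₀ hlog1
  set A : Set Θ := {θ | (E m j).expLogPlusMean κ θ₀ θ ≤ 1 + ENNReal.ofReal (L / m)} with hA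
  have hAm : MeasurableSet A :=
    measurableSet_le ((E m j).measurable_expLogPlusMean κ θ₀) measurable_const
  have hAp : ENNReal.ofReal (Real.exp (-c_π * k m * L)) ≤ prior A := hthick j
  have hA0 : prior A ≠ 0 := by
    intro h
    rw [h, nonpos_iff_eq_zero, ENNReal.ofReal_eq_zero] at hAp
    exact absurd (Real.exp_pos _) (not_lt.2 hAp)
  set P := (E m j).jointLaw θ₀ with hP
  set G₁ : Set (∀ i, (E m j).Obs i) :=
    {y | ∃ θ, M * (Real.log m / √m) ≤ (E m j).pseudoHellinger θ θ₀ ∧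
        Real.exp (-(M ^ 2 * Real.log m ^ 2 / 2)) * ∏ i, (E m j).p i θ₀ (y i) <
          ∏ i, (E m j).p i θ (y i)} with hG₁
  set G₂ : Set (∀ i, (E m j).Obs i) := {y | prior A * ENNReal.ofReal (Real.exp (2 * L)) ≤
      (E m j).ratioIntegral prior κ θ₀ A y} with hG₂
  have hPG : P (G₁ ∪ G₂) ≤ ENNReal.ofReal (2 * Real.exp (-L)) := by
    rw [two_mul, ENNReal.ofReal_add (Real.exp_pos _).le (Real.exp_pos _).le]
    exact (measure_union_le _ _).trans (add_le_add (hfar j)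
      ((E m j).measure_ratioIntegral_ge_le prior hm (by linarith) θ₀ hA hA0))
  have hdist : ∀ (θ : Θ) (x : ℝ), (E m j).pseudoHellinger θ θ₀ ^ 2 ≤ x →
      edist θ θ₀ ^ 2 ≤ ENNReal.ofReal ((x / C_L) ^ (1 / α)) := by
    intro θ x hx
    rw [edist_dist, ← ENNReal.ofReal_pow dist_nonneg]
    refine ENNReal.ofReal_le_ofReal (sq_le_rpow_of_rpow_le hα dist_nonneg ?_)
    rw [le_div_iff₀ hC_L, mul_comm]
    exact (hsep j θ θ₀).trans hx
  have hDθ : ∀ θ, edist θ θ₀ ^ 2 ≤ ENNReal.ofReal D := fun θ =>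
    hdist θ 2 ((E m j).pseudoHellinger_sq_le_two hm θ θ₀)
  set e : ℝ := (M ^ 2 * L / m / C_L) ^ (1 / α) with he
  have hint := ae_lt_top ((E m j).measurable_ratioIntegral prior κ θ₀ A)
    (((E m j).lintegral_ratioIntegral_le prior hm (L := L) (by linarith) θ₀ hA).trans_lt
      (ENNReal.mul_lt_top (measure_lt_top _ _) ENNReal.ofReal_lt_top)).ne
  obtain ⟨N, l, u, hlu⟩ := hbr j
  -- The event G₁ is a possibly uncountable union over θ, so it is replaced by a measurable hull. On
  -- the hull only the bound ρ² ≤ D is used, through β = 0.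
  have hae : ∀ᵐ y ∂P, W₂ ((E m j).posterior prior (γ m) y) (Measure.dirac θ₀) ^ 2 ≤
      (ENNReal.ofReal e + ENNReal.ofReal (2 * D * Real.exp (-L))) +
        (toMeasurable P (G₁ ∪ G₂)).indicator (fun _ => ENNReal.ofReal D) y := by
    filter_upwards [(E m j).ae_forall_density_pos θ₀, hint] with y hy hyint
    have hZ0 := (E m j).evidence_pos prior (γ := γ m) hκ hA0 hy hyint
    have hZt := (E m j).evidence_ne_top prior hlu hγ y
    by_cases hyG : y ∈ toMeasurable P (G₁ ∪ G₂)
    · rw [Set.indicator_of_mem hyG]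
      refine ((E m j).W₂_posterior_sq_le prior θ₀ hZ0 hZt (β := 0) hDθ
        fun θ => Or.inl (hDθ θ)).trans ?_
      rw [mul_zero, mul_zero, add_zero]
      exact le_add_self
    · rw [Set.indicator_of_notMem hyG, add_zero]
      have hyG' : y ∉ G₁ ∪ G₂ := fun h => hyG (subset_toMeasurable _ _ h)
      rw [Set.mem_union, not_or] at hyG'
      have hP0 : 0 ≤ ∏ i, (E m j).p i θ₀ (y i) :=
        Finset.prod_nonneg fun i _ => (E m j).nonneg_p _ _ _
      refine ((E m j).W₂_posterior_sq_le prior θ₀ hZ0 hZt (e := ENNReal.ofReal e)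
        (β := ENNReal.ofReal ((Real.exp (-(M ^ 2 * L / 2)) * ∏ i, (E m j).p i θ₀ (y i)) ^ γ m))
        hDθ fun θ => ?_).trans (add_le_add_right ?_ _)
      · by_cases hθ : M * (Real.log m / √m) ≤ (E m j).pseudoHellinger θ θ₀
        · right
          have : ¬ Real.exp (-(M ^ 2 * L / 2)) * ∏ i, (E m j).p i θ₀ (y i) <
              ∏ i, (E m j).p i θ (y i) := fun h => hyG'.1 ⟨θ, hθ, h⟩
          exact ENNReal.ofReal_le_ofReal (Real.rpow_le_rpow
            (Finset.prod_nonneg fun i _ => (E m j).nonneg_p _ _ _) (not_lt.1 this) hγ.le)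
        · left
          refine hdist θ _ ?_
          have h1 := pow_le_pow_left₀ (Real.sqrt_nonneg _ : 0 ≤ (E m j).pseudoHellinger θ θ₀)
            (not_le.1 hθ).le 2
          rw [mul_pow, div_pow, Real.sq_sqrt hm0.le, ← mul_div_assoc] at h1
          exact h1
      · have hZ := (E m j).evidence_lower_bound prior hκ hγ hL1 hAm hy (not_le.1 hyG'.2).le
        refine inv_evidence_mul_le hD0.le hP0 hZ0 hZt hAp hZ ?_
        have e1 : c_π * k m * L ≤ c_π * (g₂ * γ m) * L := by gcongr
        have e2 : L ≤ g₂ * γ m * L := le_mul_of_one_le_left (by linarith) (hk1.trans hkg)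
        have e3 := mul_le_mul_of_nonneg_right hM2 (show 0 ≤ L * γ m by positivity)
        have e4 : 3 * L / κ * γ m = 3 / κ * (L * γ m) := by ring
        rw [e4]
        nlinarith
  refine (lintegral_mono_ae hae).trans ?_
  rw [lintegral_add_left measurable_const, lintegral_const, measure_univ, mul_one,
    lintegral_indicator_const (measurableSet_toMeasurable _ _), measure_toMeasurable]
  -- The posterior tail and the exceptional event each contribute 2D e^{-L}, whence the 4D in the
  -- constant.
  refine (add_le_add_right (mul_le_mul_right hPG _) _).trans ?_
  have he0 : 0 ≤ e := by positivity
  rw [← ENNReal.ofReal_mul hD0.le, ← ENNReal.ofReal_add he0 (by positivity),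
    ← ENNReal.ofReal_add (by positivity) (by positivity)]
  refine ENNReal.ofReal_le_ofReal ?_
  have h1 : e = (M ^ 2 / C_L) ^ (1 / α) * (L / m) ^ (1 / α) := by
    rw [he, ← Real.mul_rpow (by positivity) (by positivity)]
    congr 1
    ring
  have h2 : Real.exp (-L) ≤ (L / m) ^ (1 / α) := exp_neg_log_sq_le hα hm0 hlog1 hlogα
  have h3 := mul_le_mul_of_nonneg_left h2 (show 0 ≤ 4 * D by positivity)
  rw [h1]
  linarith
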